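/- **Notation.** Let $\mathfrak h=\mathbb Z\langle x,y\rangle$, $\mathfrak h^1=\mathbb Z+y\mathfrak h$ and $\mathfrak h^{\ge2}=\mathbb Z+yx\,\mathbb Z\langle x,yx\rangle$. For $n\ge0$ put $[n]=\{1,\dots,n\}$. For $r\ge 0$ let $\mathcal T(r)$ be the set of all $S\cup S'\subset[2r]$ with $S\cap S'=\emptyset$, where $S=\bigcup_{j\in R}\{2j,2j+1\}$ for some $R\subset[r-1]$ (with $[r-1]=\emptyset$ if $r=0$), $S'=\bigcup_{j\in R'}\{2j-1,2j\}$ for some $R'\subset[r]$, and no two elements of $S'$ differ by exactly $2$. For $A\in\mathcal T(r)$ put $\kappa(A)=\#A/2$. For a finite set $S\subset\mathbb Z_{>0}$ put $\mathrm{eo}(S)=\#\{j\ge1:\{2j,2j+1\}\subset S\}$, $\mathrm{oe}(S)=\#\{j\ge1:\{2j-1,2j\}\subset S\}$ and $\sigma_S(i)=\#([i]\setminus S)$ for $i\in\mathbb Z_{>0}\setminus S$. For $\boldsymbol c=(c_1,\dots,c_{2r})\in\mathbb Z_{\ge1}^{2r}$ put $[2r]^1_{\boldsymbol c}=\{i:c_i=1\}$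 and $[2r]^{>1}_{\boldsymbol c}=\{i:c_i>1\}$; for $A\subset[2r]^1_{\boldsymbol c}$ and $B\subset[2r]^{>1}_{\boldsymbol c}$ let $\boldsymbol c_{A,B}$ be obtained from $\boldsymbol c$ by subtracting $1$ from the entries indexed by $B$ and deleting the entries indexed by $A$. **Words.** For $\epsilon\in\{0,1\}$ define $\mathfrak E^\epsilon(\boldsymbol c)$ recursively by $\mathfrak E^\epsilon(\emptyset)=1$ and, for $r\ge1$, $$\begin{aligned}\mathfrak E^\epsilon(\boldsymbol c)=&-\sum_{\substack{\emptyset\ne B\subset[2r]^{>1}_{\boldsymbol c}\\ \mathrm{eo}(B)=0}}(-1)^{\#B}\,\mathfrak E^\epsilon(\boldsymbol c_{\emptyset,B})\,x^{\#B}-\sum_{\substack{B\subset[2r]^{>1}_{\boldsymbol c},\ \mathrm{eo}(B)=0\\ \#B\ge2}}(-1)^{\#B}\,\mathfrak E^\epsilon(\boldsymbol c_{\emptyset,B})\,yx^{\#B-1}\\&+\sum_{\substack{A\subset[2r]^1_{\boldsymbol c},\ A\in\mathcal T(r)\\ B\subset[2r]^{>1}_{\boldsymbol c},\ \mathrm{oe}(\sigma_A(B))=0\\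 \#A+\#B\ge2}}(-1)^{\mathrm{eo}(A)+\#B}\,\mathfrak E^\epsilon(\boldsymbol c_{A,B})\,yx^{(1+\epsilon)\kappa(A)+\#B-1}.\end{aligned}$$ Put $\mathfrak E(\boldsymbol c)=\mathfrak E^0(\boldsymbol c)$ and $\mathfrak D(\boldsymbol c)=\mathfrak E^1(\boldsymbol c)$. **Finite sums.** For $N\ge1$ and $\boldsymbol l,\boldsymbol k\in\mathbb Z_{\ge1}^r$ let $$\zeta_N\binom{\boldsymbol l}{\boldsymbol k}=\sum_{\substack{0<n_{1,1}\le\cdots\le n_{1,l_1}\\<n_{2,1}\le\cdots\le n_{2,l_2}\\\cdots\\<n_{r,1}\le\cdots\le n_{r,l_r}<N}}\ \prod_{j=1}^r\frac1{(N-n_{j,1})\cdots(N-n_{j,l_j-1})\,n_{j,l_j}^{k_j}},\qquad \zeta_N(\boldsymbol k)=\sum_{0<n_1<\cdots<n_r<N}\ \prod_{j=1}^r\frac1{n_j^{k_j}},$$ $$\zeta_N^\diamondsuit(\boldsymbol k)=\sum_{A\subset\{i\mid k_i=1\}}\ \sum_{\substack{0<n_1\le\cdots\le n_r<N\\ n_i<n_{i+1}\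 (i\notin A,\ i<r)}}\ \Bigl(\prod_{i\in A}\frac1{N-n_i}\Bigr)\Bigl(\prod_{i\notin A}\frac1{n_i^{k_i}}\Bigr),$$ and let $Z_N:\mathfrak h^1\to\mathbb Q$ be the $\mathbb Z$-linear map with $Z_N(yx^{k_1-1}\cdots yx^{k_r-1})=\zeta_N(k_1,\dots,k_r)$ for all $r\ge0$ and $k_1,\dots,k_r\ge1$ (so $Z_N(1)=1$). **Statement.** Let $r\ge0$ and $\boldsymbol l=(l_1,\dots,l_r),\boldsymbol k=(k_1,\dots,k_r)\in\mathbb Z_{\ge1}^r$. Then $\mathfrak E(l_1,k_1,\dots,l_r,k_r)\in\mathfrak h^1$, $\mathfrak D(l_1,k_1,\dots,l_r,k_r)\in\mathfrak h^{\ge2}$, and for every $N\ge1$ $$\zeta_N\binom{\boldsymbol l}{\boldsymbol k}=Z_N\bigl(\mathfrak E(l_1,k_1,\dots,l_r,k_r)\bigr),$$ $$\zeta_N^\diamondsuit(\underbrace{1,\dots,1}_{l_1-1},k_1+1,\dots,\underbrace{1,\dots,1}_{l_r-1},k_r+1)=Z_N\bigl(\mathfrak D(l_1,k_1,\dots,l_r,k_r)\bigr).$$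 -/

import Mathlib

/-! ### The noncommutative polynomial algebra `ℤ⟨x, y⟩` -/

namespace MHS

/-- The two noncommuting variables. -/
inductive Letter : Type
  | x : Letter
  | y : Letter

/-- `𝔥 = ℤ⟨x, y⟩`. -/
abbrev NCPoly : Type := FreeAlgebra ℤ Letter

/-- The variable `x` of `𝔥`. -/
noncomputable def X : NCPoly := FreeAlgebra.ι ℤ Letter.x

/-- The variable `y` of `𝔥`. -/
noncomputable def Y : NCPoly := FreeAlgebra.ι ℤ Letter.y

/-- `𝔥¹ = ℤ + y 𝔥`. -/
noncomputable def hOne : Submodule ℤ NCPoly :=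
  Submodule.span ℤ {1} ⊔ LinearMap.range (LinearMap.mulLeft ℤ Y)

/-- `𝔥^{≥2} = ℤ + yx ℤ⟨x, yx⟩`. -/
noncomputable def hGeTwo : Submodule ℤ NCPoly :=
  Submodule.span ℤ {1} ⊔
    (Subalgebra.toSubmodule (Algebra.adjoin ℤ {X, Y * X})).map (LinearMap.mulLeft ℤ (Y * X))

theorem hGeTwo_le_hOne : hGeTwo ≤ hOne := by
  refine sup_le_sup le_rfl ?_
  rintro _ ⟨u, -, rfl⟩
  exact ⟨X * u, by simp⟩

/-! ### Combinatorics of subsets of `[n] = {1, …, n}` -/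

/-- Unions of even-odd dominoes `{2j, 2j+1}` with `1 ≤ j ≤ r - 1`. -/
def EO (r : ℕ) : Finset (Finset ℕ) :=
  (Finset.Icc 1 (r - 1)).powerset.image fun R => R.biUnion fun j => {2 * j, 2 * j + 1}

/-- Unions of odd-even dominoes `{2j-1, 2j}` with `1 ≤ j ≤ r`. -/
def OE (r : ℕ) : Finset (Finset ℕ) :=
  (Finset.Icc 1 r).powerset.image fun R => R.biUnion fun j => {2 * j - 1, 2 * j}

/-- Members of `OE r` with no two elements at distance exactly `2`. -/
def OEStar (r : ℕ) : Finset (Finset ℕ) :=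
  (OE r).filter fun S => ∀ i ∈ S, ∀ j ∈ S, |(i : ℤ) - (j : ℤ)| ≠ 2

/-- `𝒯(r)`: partial domino tilings of `[2r]` in which no two odd-even dominoes are adjacent. -/
def Tilings (r : ℕ) : Finset (Finset ℕ) :=
  ((EO r ×ˢ OEStar r).filter fun p => Disjoint p.1 p.2).image fun p => p.1 ∪ p.2

/-- `κ(T) = #T / 2`; every `T ∈ 𝒯(r)` has even cardinality. -/
def kappa (T : Finset ℕ) : ℕ := T.card / 2

/-- `eo(S) = #{j ≥ 1 : {2j, 2j+1} ⊆ S}`; all such `j` are at most `max S`. -/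
def eo (S : Finset ℕ) : ℕ :=
  ((Finset.Icc 1 (S.sup id)).filter fun j => 2 * j ∈ S ∧ 2 * j + 1 ∈ S).card

/-- `oe(S) = #{j ≥ 1 : {2j-1, 2j} ⊆ S}`; all such `j` are at most `max S`. -/
def oe (S : Finset ℕ) : ℕ :=
  ((Finset.Icc 1 (S.sup id)).filter fun j => 2 * j - 1 ∈ S ∧ 2 * j ∈ S).card

/-- `σ_S(i) = #([i] \ S)`. -/
def sigma (S : Finset ℕ) (i : ℕ) : ℕ := (Finset.Icc 1 i \ S).card

/-- `{i ∈ [n] : c_i = 1}` for `c = (c_1, …, c_n)`. -/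
def onePos (c : List ℕ) : Finset ℕ :=
  (Finset.Icc 1 c.length).filter fun i => c.getD (i - 1) 0 = 1

/-- `{i ∈ [n] : c_i > 1}` for `c = (c_1, …, c_n)`. -/
def gtPos (c : List ℕ) : Finset ℕ :=
  (Finset.Icc 1 c.length).filter fun i => 1 < c.getD (i - 1) 0

/-- Subtract `1` from the entries with position in `B` and delete those with position in `A`,
where the first entry has position `s`. -/
def reduceFrom (s : ℕ) (c : List ℕ) (A B : Finset ℕ) : List ℕ :=
  ((c.zipIdx s).filter fun p => p.2 ∉ A).map fun p => if p.2 ∈ B then p.1 - 1 else p.1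

/-- `c_{A,B}`: subtract `1` from the entries indexed by `B` and delete those indexed by `A`,
positions being counted from `1`. -/
def reduce (c : List ℕ) (A B : Finset ℕ) : List ℕ := reduceFrom 1 c A B

theorem reduceFrom_cons (s a : ℕ) (c : List ℕ) (A B : Finset ℕ) :
    reduceFrom s (a :: c) A B =
      if s ∈ A then reduceFrom (s + 1) c A B
      else (if s ∈ B then a - 1 else a) :: reduceFrom (s + 1) c A B := by
  by_cases h : s ∈ A <;> simp [reduceFrom, List.zipIdx_cons, h]

theorem size_reduceFrom_le (A B : Finset ℕ) (c : List ℕ) : ∀ s : ℕ,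
    (reduceFrom s c A B).sum + (reduceFrom s c A B).length ≤ c.sum + c.length := by
  induction c with
  | nil => intro s; simp [reduceFrom]
  | cons a c ih =>
    intro s
    have := ih (s + 1)
    rw [reduceFrom_cons]
    split_ifs <;> simp <;> omega

theorem size_reduceFrom_lt (A B : Finset ℕ) (c : List ℕ) : ∀ s i : ℕ, i < c.length →
    (s + i ∈ A ∨ (s + i ∈ B ∧ 1 < c.getD i 0)) →
    (reduceFrom s c A B).sum + (reduceFrom s c A B).length < c.sum + c.length := by
  induction c with
  | nil => intro s i hi; simp at hi
  | cons a c ih =>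
    intro s i hi h
    rw [reduceFrom_cons]
    cases i with
    | zero =>
      have := size_reduceFrom_le A B c (s + 1)
      simp only [add_zero, List.getD_cons_zero] at h
      split_ifs with h1 h2
      · simp; omega
      · rcases h with h | h
        · exact absurd h h1
        · simp; omega
      · tauto
    | succ i =>
      have := ih (s + 1) i (by simpa using hi) (by
        simpa [add_assoc, add_comm, add_left_comm] using h)
      split_ifs <;> simp <;> omega

theorem size_reduce_lt {c : List ℕ} {A B : Finset ℕ} (hA : A ⊆ onePos c) (hB : B ⊆ gtPos c)
    (h : 0 < A.card + B.card) :
    (reduce c A B).sum + (reduce c A B).length < c.sum + c.length := by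
  rcases A.eq_empty_or_nonempty with rfl | ⟨i, hi⟩
  · obtain ⟨i, hi⟩ : B.Nonempty := by
      rw [← Finset.card_pos]; simpa using h
    have := hB hi
    simp only [gtPos, Finset.mem_filter, Finset.mem_Icc] at this
    refine size_reduceFrom_lt _ _ c 1 (i - 1) (by omega) (Or.inr ⟨?_, this.2⟩)
    rwa [show 1 + (i - 1) = i by omega]
  · have := hA hi
    simp only [onePos, Finset.mem_filter, Finset.mem_Icc] at this
    refine size_reduceFrom_lt _ _ c 1 (i - 1) (by omega) (Or.inl ?_)
    rwa [show 1 + (i - 1) = i by omega]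

/-! ### The words `𝔈(c)` and `𝔇(c)` -/

/-- Index set of the first sum: nonempty `B ⊆ [2r]_c^{>1}` with `eo(B) = 0`. -/
def indexOne (c : List ℕ) : Finset (Finset ℕ) :=
  (gtPos c).powerset.filter fun B => eo B = 0 ∧ B ≠ ∅

/-- Index set of the second sum: `B ⊆ [2r]_c^{>1}` with `eo(B) = 0` and `#B ≥ 2`. -/
def indexTwo (c : List ℕ) : Finset (Finset ℕ) :=
  (gtPos c).powerset.filter fun B => eo B = 0 ∧ 2 ≤ B.card

/-- Index set of the third sum: pairs `(A, B)` with `A ⊆ [2r]_c^1`, `A ∈ 𝒯(r)`,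
`B ⊆ [2r]_c^{>1}`, `oe(σ_A(B)) = 0` and `#A + #B ≥ 2`, where `2r` is the length of `c`. -/
def indexThree (c : List ℕ) : Finset (Finset ℕ × Finset ℕ) :=
  ((onePos c).powerset ×ˢ (gtPos c).powerset).filter fun p =>
    p.1 ∈ Tilings (c.length / 2) ∧ oe (p.2.image (sigma p.1)) = 0 ∧ 2 ≤ p.1.card + p.2.card

theorem indexOne_lt {c : List ℕ} {B : Finset ℕ} (h : B ∈ indexOne c) :
    (reduce c ∅ B).sum + (reduce c ∅ B).length < c.sum + c.length := by
  simp only [indexOne, Finset.mem_filter, Finset.mem_powerset] at h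
  have := Finset.card_pos.2 (Finset.nonempty_iff_ne_empty.2 h.2.2)
  exact size_reduce_lt (by simp) h.1 (by omega)

theorem indexTwo_lt {c : List ℕ} {B : Finset ℕ} (h : B ∈ indexTwo c) :
    (reduce c ∅ B).sum + (reduce c ∅ B).length < c.sum + c.length := by
  simp only [indexTwo, Finset.mem_filter, Finset.mem_powerset] at h
  exact size_reduce_lt (by simp) h.1 (by omega)

theorem indexThree_lt {c : List ℕ} {p : Finset ℕ × Finset ℕ} (h : p ∈ indexThree c) :
    (reduce c p.1 p.2).sum + (reduce c p.1 p.2).length < c.sum + c.length := by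
  simp only [indexThree, Finset.mem_filter, Finset.mem_product, Finset.mem_powerset] at h
  exact size_reduce_lt h.1.1 h.1.2 (by omega)

/-- `𝔈^ε(c)` for `ε ∈ {0, 1}` and `c = (c_1, …, c_{2r})`; the recursion is well founded because
`c_{A,B}` is smaller than `c`. The recursion without `attach` is `wordE_eq`. -/
noncomputable def wordE (ε : ℕ) (c : List ℕ) : NCPoly :=
  if c = [] then 1
  else
    - (∑ B ∈ (indexOne c).attach,
        (-1 : ℤ) ^ B.1.card • (wordE ε (reduce c ∅ B.1) * X ^ B.1.card))
    - (∑ B ∈ (indexTwo c).attach,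
        (-1 : ℤ) ^ B.1.card • (wordE ε (reduce c ∅ B.1) * (Y * X ^ (B.1.card - 1))))
    + ∑ p ∈ (indexThree c).attach,
        (-1 : ℤ) ^ (eo p.1.1 + p.1.2.card) •
          (wordE ε (reduce c p.1.1 p.1.2) *
            (Y * X ^ ((1 + ε) * kappa p.1.1 + p.1.2.card - 1)))
termination_by c.sum + c.length
decreasing_by
  · exact indexOne_lt B.2
  · exact indexTwo_lt B.2
  · exact indexThree_lt p.2

theorem wordE_nil (ε : ℕ) : wordE ε [] = 1 := by
  rw [wordE]; simp

theorem wordE_eq (ε : ℕ) {c : List ℕ} (hc : c ≠ []) :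
    wordE ε c =
      - (∑ B ∈ indexOne c, (-1 : ℤ) ^ B.card • (wordE ε (reduce c ∅ B) * X ^ B.card))
      - (∑ B ∈ indexTwo c,
          (-1 : ℤ) ^ B.card • (wordE ε (reduce c ∅ B) * (Y * X ^ (B.card - 1))))
      + ∑ p ∈ indexThree c,
          (-1 : ℤ) ^ (eo p.1 + p.2.card) •
            (wordE ε (reduce c p.1 p.2) *
              (Y * X ^ ((1 + ε) * kappa p.1 + p.2.card - 1))) := by
  rw [wordE, if_neg hc,
    Finset.sum_attach (indexOne c)
      (fun B => (-1 : ℤ) ^ B.card • (wordE ε (reduce c ∅ B) * X ^ B.card)),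
    Finset.sum_attach (indexTwo c)
      (fun B => (-1 : ℤ) ^ B.card • (wordE ε (reduce c ∅ B) * (Y * X ^ (B.card - 1)))),
    Finset.sum_attach (indexThree c)
      (fun p => (-1 : ℤ) ^ (eo p.1 + p.2.card) • (wordE ε (reduce c p.1 p.2) *
              (Y * X ^ ((1 + ε) * kappa p.1 + p.2.card - 1))))]

/-- `𝔈(c) = 𝔈⁰(c)`. -/
noncomputable def frakE (c : List ℕ) : NCPoly := wordE 0 c

/-- `𝔇(c) = 𝔈¹(c)`. -/
noncomputable def frakD (c : List ℕ) : NCPoly := wordE 1 c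

/-! ### Finite multiple harmonic sums -/

/-- `ζ_N(k_1, …, k_r) = ∑_{0 < n_1 < ⋯ < n_r < N} ∏ 1 / n_j ^ k_j`. -/
def zetaN (N : ℕ) (k : List ℕ) : ℚ :=
  ∑ n ∈ (Fintype.piFinset fun _ : Fin k.length => Finset.Ioo 0 N) with
      ∀ i j : Fin k.length, i < j → n i < n j,
    ∏ j, 1 / (n j : ℚ) ^ k.get j

/-- `ζ_N(l; k)`: the sum over arrays `n_{j,i}` (`1 ≤ j ≤ r`, `1 ≤ i ≤ l_j`) of integers in
`(0, N)` that increase weakly along each row, every entry of a row being smaller than every entry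
of the following rows. The last entry of row `j` contributes `1 / n ^ k_j`, every other
entry `1 / (N - n)`. -/
def zetaBinom (N : ℕ) {r : ℕ} (l k : Fin r → ℕ) : ℚ :=
  ∑ n ∈ (Fintype.piFinset fun j : Fin r =>
        Fintype.piFinset fun _ : Fin (l j) => Finset.Ioo 0 N) with
      (∀ j : Fin r, ∀ a b : Fin (l j), a ≤ b → n j a ≤ n j b) ∧
      (∀ j j' : Fin r, j < j' → ∀ (a : Fin (l j)) (b : Fin (l j')), n j a < n j' b),
    ∏ j, ∏ i : Fin (l j),
      if (i : ℕ) + 1 = l j then 1 / (n j i : ℚ) ^ k j else 1 / ((N : ℚ) - (n j i : ℚ))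

/-- `ζ_N^◇(k) = ∑_{A ⊆ {i : k_i = 1}} ∑ ∏_{i ∈ A} 1 / (N - n_i) ∏_{i ∉ A} 1 / n_i ^ k_i`, the
inner sum being over `0 < n_1 ≤ ⋯ ≤ n_r < N` with `n_i < n_{i+1}` whenever `i ∉ A`. -/
def zetaDiamond (N : ℕ) (k : List ℕ) : ℚ :=
  ∑ A ∈ (Finset.univ.filter fun i : Fin k.length => k.get i = 1).powerset,
    ∑ n ∈ (Fintype.piFinset fun _ : Fin k.length => Finset.Ioo 0 N) with
        ∀ i j : Fin k.length, (i : ℕ) + 1 = j → n i ≤ n j ∧ (i ∉ A → n i < n j),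
      (∏ i ∈ A, 1 / ((N : ℚ) - (n i : ℚ))) * ∏ i ∈ Aᶜ, 1 / (n i : ℚ) ^ k.get i

/-! ### The evaluation map `Z_N` -/

/-- The word `y x^{k_1-1} ⋯ y x^{k_r-1}`. -/
def indexWord (k : List ℕ) : FreeMonoid Letter :=
  FreeMonoid.ofList (k.flatMap fun m => Letter.y :: List.replicate (m - 1) Letter.x)

/-- Reads a word as `x^m y x^{k_1-1} ⋯ y x^{k_r-1}` and returns `(m, [k_1, …, k_r])`. -/
def scanWord : List Letter → ℕ × List ℕ
  | [] => (0, [])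
  | Letter.x :: w => ((scanWord w).1 + 1, (scanWord w).2)
  | Letter.y :: w => (0, ((scanWord w).1 + 1) :: (scanWord w).2)

/-- The index `[k_1, …, k_r]` of the word `y x^{k_1-1} ⋯ y x^{k_r-1}`. -/
def wordIndex (w : FreeMonoid Letter) : List ℕ := (scanWord (FreeMonoid.toList w)).2

/-- `Z_N : 𝔥¹ → ℚ`, the `ℤ`-linear map with
`Z_N(y x^{k_1-1} ⋯ y x^{k_r-1}) = ζ_N(k_1, …, k_r)`; see `ZN_indexWord`. -/
noncomputable def ZN (N : ℕ) : hOne →ₗ[ℤ] ℚ :=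
  ((FreeAlgebra.basisFreeMonoid ℤ Letter).constr ℤ fun w => zetaN N (wordIndex w)).domRestrict
    hOne

theorem scanWord_replicate (m : ℕ) (w : List Letter) :
    scanWord (List.replicate m Letter.x ++ w) = ((scanWord w).1 + m, (scanWord w).2) := by
  induction m with
  | zero => simp
  | succ m ih => simp [List.replicate_succ, scanWord, ih, add_assoc]

theorem scanWord_flatMap (k : List ℕ) (hk : ∀ m ∈ k, 1 ≤ m) :
    scanWord (k.flatMap fun m => Letter.y :: List.replicate (m - 1) Letter.x) = (0, k) := by
  induction k with
  | nil => simp [scanWord]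
  | cons a k ih =>
    have h1 := ih fun m hm => hk m (by simp [hm])
    have h2 := hk a (by simp)
    simp only [List.flatMap_cons, List.cons_append, scanWord, scanWord_replicate, h1]
    simp; omega

theorem basisFreeMonoid_apply (w : FreeMonoid Letter) :
    FreeAlgebra.basisFreeMonoid ℤ Letter w = FreeMonoid.lift (FreeAlgebra.ι ℤ) w := by
  simp [FreeAlgebra.basisFreeMonoid, FreeAlgebra.equivMonoidAlgebraFreeMonoid]
  exact one_smul ℤ _

theorem ZN_indexWord (N : ℕ) (k : List ℕ) (hk : ∀ m ∈ k, 1 ≤ m)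
    (h : (k.map fun m => Y * X ^ (m - 1)).prod ∈ hOne) :
    ZN N ⟨(k.map fun m => Y * X ^ (m - 1)).prod, h⟩ = zetaN N k := by
  have key : (k.map fun m => Y * X ^ (m - 1)).prod =
      FreeAlgebra.basisFreeMonoid ℤ Letter (indexWord k) := by
    rw [basisFreeMonoid_apply]
    clear h hk
    induction k with
    | nil => simp [indexWord]
    | cons a k ih =>
      rw [List.map_cons, List.prod_cons, ih]
      simp [indexWord, FreeMonoid.ofList_append, FreeMonoid.lift_apply, X, Y, mul_assoc]
  change (FreeAlgebra.basisFreeMonoid ℤ Letter).constr ℤ (fun w => zetaN N (wordIndex w))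
    (k.map fun m => Y * X ^ (m - 1)).prod = zetaN N k
  rw [key, Module.Basis.constr_basis, wordIndex, indexWord, FreeMonoid.toList_ofList, scanWord_flatMap k hk]

end MHS

namespace MHS

/-! Both families are instances of one sum `coeffSum a b N c m`: inside a row an entry n contributes
1/(N-n) before a weak step or b(n) before a strict one, and the last entry contributes a(n)/n^k. The
choices a = 1, b = 0 and a = b = 1/n give ζ_N(l;k) and ζ_N^◇ (`binomFrom_eq`, `diamondFrom_eq`). In
both cases a(m) = q(1 + b(m)(N-m)), with q = 1 and q = 1/N respectively (`lastCoeff_eq`); this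
relation is all that the argument needs of a and b.

Attach a variable x_j to l_j and y_j to k_j. The number of repetitions of a value in a row is summed
by a geometric series, so the generating function G_N of the sums with entries greater than m has
the closed form `kernelSum`. The heart of the proof is `kernelSum_succ_eq_tileSum`: the product (1 -
x_1/(N-m)) (1 - (y_1+x_2)/N) ⋯ (1 - y_r/N) G_{N+1} equals a sum over the tilings A of (-1)^{eo(A)}
(q/N)^{κ(A)} times the product of the factors 1 - (z+z')/N over consecutive pairs of surviving
variables times G_N of the survivors. It is proved by descending induction on m inside an induction
on the number of pairs. At m = 0 the left product expands over the sets B with eo(B) = 0 and the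
right one over those with oe(σ_A(B)) = 0, and comparing coefficients gives the difference equation
`coeffSum_succ`.

On the side of words, Z_{N+1} - Z_N takes w y x^j to N^{-(j+1)} Z_N(w) and, for w in y𝔥, multiplies
by N^{-j} when w is replaced by w x^j (`zetaLin_succ_mul`, `zetaLin_succ_mul_X_pow`). The recursion
of 𝔈^ε therefore says that Z_N(𝔈^ε(c)) obeys the same difference equation; the terms with A = ∅ and
#B ≤ 1 cancel. For N = 1 both sides vanish unless c is empty, so induction on N and then on the size
of c concludes (`zetaLin_wordE`). The memberships in 𝔥¹ and 𝔥^{≥2} are read off the recursion. -/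

theorem exists_cons_cons {α : Type*} {u : List α} {k : ℕ} (hu : u.length = 2 * (k + 1)) :
    ∃ x y v, u = x :: y :: v ∧ v.length = 2 * k := by
  match u, hu with
  | x :: y :: v, hu => exact ⟨x, y, v, rfl, by simp at hu; omega⟩

/-! ### Generating functions of the finite sums -/

section GeneratingFunctions

variable {K : Type*} [Field K]

/-- The generating function of the sums over `m < n_1 < ⋯ < n_r < N`; the list holds the variables
`x_1, y_1, …, x_r, y_r`. -/
def kernelSum (a b : ℕ → K) (N : ℕ) : List K → ℕ → K
  | [], _ => 1
  | [_], _ => 0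
  | x :: y :: u, m => ∑ n ∈ Finset.Ioo m N,
      (∏ i ∈ Finset.Ioo m n, ((N : K) - i) * (1 + b i * x) / (N - i - x)) *
        (((N : K) - n) / (N - n - x) * (a n / (n - y)) * kernelSum a b N u n)

theorem kernelSum_nil (a b : ℕ → K) (N m : ℕ) : kernelSum a b N [] m = 1 := by
  rw [kernelSum]

theorem kernelSum_of_le (a b : ℕ → K) (N : ℕ) (x y : K) (u : List K) {m : ℕ} (h : N ≤ m + 1) :
    kernelSum a b N (x :: y :: u) m = 0 := by
  rw [kernelSum, Finset.sum_eq_zero fun n hn => ?_]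
  have := Finset.mem_Ioo.1 hn
  omega

theorem Ioo_eq_insert {m N : ℕ} (h : m + 1 < N) :
    Finset.Ioo m N = insert (m + 1) (Finset.Ioo (m + 1) N) := by
  ext i; simp; omega

/-- The term n = m+1 is split off; all later terms share the factor belonging to i = m+1. -/
theorem kernelSum_step (a b : ℕ → K) (N : ℕ) (x y : K) (u : List K) {m : ℕ} (h : m + 1 < N)
    (hx : (N : K) - (m + 1 : ℕ) - x ≠ 0) :
    ((N : K) - (m + 1 : ℕ) - x) * kernelSum a b N (x :: y :: u) m =
      (N - (m + 1 : ℕ)) * ((1 + b (m + 1) * x) * kernelSum a b N (x :: y :: u) (m + 1) +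
        a (m + 1) / ((m + 1 : ℕ) - y) * kernelSum a b N u (m + 1)) := by
  have key : kernelSum a b N (x :: y :: u) m =
      ((N : K) - (m + 1 : ℕ)) * (1 + b (m + 1) * x) / (N - (m + 1 : ℕ) - x) *
        kernelSum a b N (x :: y :: u) (m + 1) +
      ((N : K) - (m + 1 : ℕ)) / (N - (m + 1 : ℕ) - x) *
        (a (m + 1) / ((m + 1 : ℕ) - y)) * kernelSum a b N u (m + 1) := by
    rw [kernelSum, kernelSum, Ioo_eq_insert h, Finset.sum_insert (by simp), add_comm]
    congr 1
    · rw [Finset.mul_sum]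
      refine Finset.sum_congr rfl fun n hn => ?_
      rw [Ioo_eq_insert (Finset.mem_Ioo.1 hn).1, Finset.prod_insert (by simp)]
      ring
    · have : Finset.Ioo m (m + 1) = ∅ := by ext i; simp
      rw [this, Finset.prod_empty, one_mul]
  rw [key]
  field_simp

/-- The product of the factors `1 - t (z_1 + z_2)` over consecutive pairs of a list. -/
def pairProd {R : Type*} [CommRing R] (t : R) : List R → R
  | [] => 1
  | [y] => 1 - t * y
  | x :: y :: u => (1 - t * (x + y)) * pairProd t u

end GeneratingFunctions

/-! ### Weighted sums over domino tilings of a list -/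

/-- States of the automaton that reads a tiling two positions at a time: no domino is pending, an
even-odd domino is half read, or the last two positions form an odd-even domino. -/
inductive TileState : Type
  | free | mid | closed

section TileSum

variable {ι K : Type*} [CommRing K]

/-- The sum of `f` over the lists left after removing dominoes, each odd-even domino having weight
`δ` and each even-odd one `-δ`. -/
def tileSum (δ : K) : List ι → TileState → (List ι → K) → K
  | [], .mid, _ => 0
  | [], .free, f => f []
  | [], .closed, f => f []
  | [_], _, _ => 0
  | i :: j :: u, .free, f => tileSum δ u .free (fun v => f (i :: j :: v)) +
      tileSum δ u .mid (fun v => f (i :: v)) + δ * tileSum δ u .closed f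
  | i :: j :: u, .closed, f => tileSum δ u .free (fun v => f (i :: j :: v)) +
      tileSum δ u .mid (fun v => f (i :: v))
  | _ :: j :: u, .mid, f => -δ * (tileSum δ u .free (fun v => f (j :: v)) + tileSum δ u .mid f)

theorem tileSum_free (δ : K) (i j : ι) (u : List ι) (f : List ι → K) :
    tileSum δ (i :: j :: u) .free f =
      tileSum δ (i :: j :: u) .closed f + δ * tileSum δ u .closed f := by
  simp only [tileSum]

theorem tileSum_linear (δ α β : K) : ∀ (u : List ι) (q : TileState) (f g : List ι → K),
    tileSum δ u q (fun v => α * f v + β * g v) = α * tileSum δ u q f + β * tileSum δ u q g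
  | [], .mid, f, g => by simp [tileSum]
  | [], .free, f, g => by simp [tileSum]
  | [], .closed, f, g => by simp [tileSum]
  | [_], _, f, g => by simp [tileSum]
  | i :: j :: u, .free, f, g => by simp only [tileSum, tileSum_linear δ α β u]; ring
  | i :: j :: u, .closed, f, g => by simp only [tileSum, tileSum_linear δ α β u]; ring
  | i :: j :: u, .mid, f, g => by simp only [tileSum, tileSum_linear δ α β u]; ring

theorem tileSum_mul (δ α : K) (u : List ι) (q : TileState) (f : List ι → K) :
    tileSum δ u q (fun v => α * f v) = α * tileSum δ u q f := by
  have := tileSum_linear δ α 0 u q f f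
  simpa using this

theorem tileSum_map {κ : Type*} (δ : K) (z : ι → κ) :
    ∀ (u : List ι) (q : TileState) (f : List κ → K),
    tileSum δ u q (fun v => f (v.map z)) = tileSum δ (u.map z) q f
  | [], .mid, f => by simp [tileSum]
  | [], .free, f => by simp [tileSum]
  | [], .closed, f => by simp [tileSum]
  | [_], _, f => by simp [tileSum]
  | i :: j :: u, .free, f => by
    simp only [List.map_cons, tileSum, ← tileSum_map δ z u]
  | i :: j :: u, .closed, f => by
    simp only [List.map_cons, tileSum, ← tileSum_map δ z u]
  | i :: j :: u, .mid, f => by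
    simp only [List.map_cons, tileSum, ← tileSum_map δ z u]

end TileSum

/-! ### The difference equation for the generating functions -/

section MainIdentity

variable {K : Type*} [Field K]

/-- The summand of the tiling sum. -/
def tileTerm (a b : ℕ → K) (N m : ℕ) (u : List K) : K :=
  pairProd (1 / (N : K)) u * kernelSum a b N u m

/-- The pair x, y stays in front of every surviving list, so `kernelSum_step` applies to each
summand and passes through the tiling sum by linearity. -/
theorem tileSum_free_cons_step (a b : ℕ → K) (δ : K) (N m : ℕ) (h : m + 1 < N)
    (x y : K) (u : List K) (hx : (N : K) - (m + 1 : ℕ) - x ≠ 0) :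
    ((N : K) - (m + 1 : ℕ) - x) *
        tileSum δ u .free (fun v => tileTerm a b N m (x :: y :: v)) =
      (N - (m + 1 : ℕ)) * ((1 + b (m + 1) * x) *
        tileSum δ u .free (fun v => tileTerm a b N (m + 1) (x :: y :: v)) +
        (1 - 1 / N * (x + y)) * (a (m + 1) / ((m + 1 : ℕ) - y)) *
          tileSum δ u .free (tileTerm a b N (m + 1))) := by
  rw [← tileSum_mul, mul_add, ← mul_assoc, ← mul_assoc, ← tileSum_linear]
  congr 1
  funext v
  simp only [tileTerm, pairProd]
  linear_combination (1 - 1 / (N : K) * (x + y)) * pairProd (1 / (N : K)) v *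
    kernelSum_step a b N x y v h hx

/-- An even-odd domino on y and x₂ leaves x next to y₂, and the possible continuations are those of
the closed state for the shortened list beginning with x, y₂. -/
theorem tileSum_closed_cons_cons (δ x y x₂ y₂ : K) (u : List K) (f : List K → K) :
    tileSum δ (x :: y :: x₂ :: y₂ :: u) .closed f =
      tileSum δ (x₂ :: y₂ :: u) .free (fun v => f (x :: y :: v)) -
        δ * tileSum δ (x :: y₂ :: u) .closed f := by
  simp only [tileSum]; ring

/-- The closed tiling sum inherits the recursion of `kernelSum_step`, its source term freed of the
pole at y, up to an error (x - (N-m-1))β. The point is that β does not depend on x: the error can be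
eliminated between two instances that differ only in the first variable. -/
theorem tileSum_closed_step (a b : ℕ → K) (δ : K) (N m : ℕ) (hN : (N : K) ≠ 0) (h : m + 1 < N)
    (k : ℕ) : ∀ (y : K) (u : List K), u.length = 2 * k →
      (∀ z ∈ y :: u, ((m + 1 : ℕ) : K) - z ≠ 0) →
      ∃ β : K, ∀ x : K, (N : K) - (m + 1 : ℕ) - x ≠ 0 →
        ((N : K) - (m + 1 : ℕ) - x) *
            tileSum δ (x :: y :: u) .closed (tileTerm a b N m) =
          (N - (m + 1 : ℕ)) * ((1 + b (m + 1) * x) *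
            tileSum δ (x :: y :: u) .closed (tileTerm a b N (m + 1)) +
            a (m + 1) / N * tileSum δ u .closed (tileTerm a b N (m + 1)) +
            (x - (N - (m + 1 : ℕ))) * β) := by
  induction k with
  | zero =>
    intro y u hu hz
    obtain rfl : u = [] := List.length_eq_zero_iff.1 (by omega)
    have hy := hz y (by simp)
    refine ⟨-(1 / N * (a (m + 1) / ((m + 1 : ℕ) - y))), fun x hx => ?_⟩
    have h1 := tileSum_free_cons_step a b δ N m h x y [] hx
    simp only [tileSum, add_zero] at h1 ⊢
    rw [h1]
    simp only [tileTerm, pairProd, kernelSum]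
    field_simp
    ring
  | succ k ih =>
    intro y u hu hz
    obtain ⟨x₂, y₂, u, rfl, hu'⟩ := exists_cons_cons hu
    have hy := hz y (by simp)
    obtain ⟨β, hβ⟩ := ih y₂ u hu' (fun z hz' => hz z (by simp at hz' ⊢; tauto))
    -- The second part is the error of the list in which a domino has removed y and x₂, weighted by
    -- -δ.
    refine ⟨-(1 / N * (a (m + 1) / ((m + 1 : ℕ) - y))) *
      tileSum δ (x₂ :: y₂ :: u) .free (tileTerm a b N (m + 1)) - δ * β,
      fun x hx => ?_⟩
    have h1 := tileSum_free_cons_step a b δ N m h x y (x₂ :: y₂ :: u) hx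
    have h2 := hβ x hx
    rw [tileSum_closed_cons_cons, tileSum_closed_cons_cons]
    have h3 := tileSum_free δ x₂ y₂ u (tileTerm a b N (m + 1))
    -- Here N - x - y = (m+1-y) + (N-(m+1)-x): the first summand cancels the pole in y, the second
    -- goes into β.
    have h4 : (1 - 1 / N * (x + y)) * (a (m + 1) / ((m + 1 : ℕ) - y)) =
        a (m + 1) / N - (x - (N - (m + 1 : ℕ))) * (1 / N * (a (m + 1) / ((m + 1 : ℕ) - y))) := by
      field_simp
      ring
    rw [h4] at h1
    linear_combination h1 - δ * h2 + (N - (m + 1 : ℕ)) * (a (m + 1) / N) * h3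

theorem tileSum_zero (δ : K) (u : List K) (q : TileState) :
    tileSum δ u q (fun _ => (0 : K)) = 0 := by
  simpa using tileSum_mul δ 0 u q (fun _ => (0 : K))

theorem tileSum_closed_of_le (a b : ℕ → K) (δ : K) (N m : ℕ) (h : N ≤ m + 1) (k : ℕ) :
    ∀ (x y : K) (u : List K), u.length = 2 * k →
      tileSum δ (x :: y :: u) .closed (tileTerm a b N m) = 0 := by
  have hf : ∀ x y : K, (fun v => tileTerm a b N m (x :: y :: v)) = fun _ => 0 := by
    intro x y; funext v; rw [tileTerm, kernelSum_of_le _ _ _ _ _ _ h, mul_zero]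
  induction k with
  | zero =>
    intro x y u hu
    obtain rfl : u = [] := List.length_eq_zero_iff.1 (by omega)
    simp [tileSum, tileTerm, kernelSum_of_le _ _ _ _ _ _ h]
  | succ k ih =>
    intro x y u hu
    obtain ⟨x₂, y₂, u, rfl, hu'⟩ := exists_cons_cons hu
    rw [tileSum_closed_cons_cons, hf, tileSum_zero, ih _ _ _ hu']
    simp

/-- The difference equation in `N` of the generating functions. -/
theorem kernelSum_succ_eq_tileSum (a b : ℕ → K) (q : K) (N : ℕ)
    (hN : ∀ n : ℕ, 1 ≤ n → n ≤ N → (n : K) ≠ 0)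
    (hab : ∀ m : ℕ, 1 ≤ m → m ≤ N → a m = q * (1 + b m * (N - m))) (k : ℕ) :
    ∀ (x y : K) (u : List K), u.length = 2 * k →
      (∀ z ∈ x :: y :: u, ∀ n : ℕ, 1 ≤ n → n ≤ N → (n : K) - z ≠ 0) →
      ∀ m < N, (1 - x / (N - m)) * pairProd (1 / (N : K)) (y :: u) *
        kernelSum a b (N + 1) (x :: y :: u) m =
          tileSum (q / N) (x :: y :: u) .free (tileTerm a b N m) := by
  -- For N+1 the step from m to m+1 has the factor N-m in place of N-(m+1), so the prefactor 1 -
  -- x/(N-m) is exactly the denominator to be cleared.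
  have red : ∀ (x y : K) (u : List K) (m : ℕ), m < N → (∀ n : ℕ, 1 ≤ n → n ≤ N → (n : K) - x ≠ 0) →
      (1 - x / ((N : K) - m)) * kernelSum a b (N + 1) (x :: y :: u) m =
        (1 + b (m + 1) * x) * kernelSum a b (N + 1) (x :: y :: u) (m + 1) +
        a (m + 1) / ((m + 1 : ℕ) - y) * kernelSum a b (N + 1) u (m + 1) := by
    intro x y u m hm hx
    have e : ((N + 1 : ℕ) : K) - (m + 1 : ℕ) = N - m := by push_cast; ring
    have e2 : (N : K) - m = (N - m : ℕ) := by rw [Nat.cast_sub hm.le]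
    have h0 : (N : K) - m ≠ 0 := by rw [e2]; exact hN _ (by omega) (by omega)
    have h1 : (N : K) - m - x ≠ 0 := by rw [e2]; exact hx _ (by omega) (by omega)
    have := kernelSum_step a b (N + 1) x y u (m := m) (by omega) (by rw [e]; exact h1)
    rw [e] at this
    rw [← mul_right_inj' h0, ← this]
    field_simp
  induction k with
  | zero =>
    intro x y u hu hz m hm
    obtain rfl : u = [] := List.length_eq_zero_iff.1 (by omega)
    have hN0 : (N : K) ≠ 0 := hN N (by omega) le_rfl
    have hr := red x y [] m hm (hz x (by simp))
    have hy : ((m + 1 : ℕ) : K) - y ≠ 0 := hz y (by simp) _ (by omega) (by omega)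
    -- Since N = m + t + 1, induction on t is descending induction on m.
    obtain ⟨t, ht⟩ := Nat.exists_eq_add_of_lt hm
    rw [mul_right_comm, hr, tileSum_free]
    induction t generalizing m with
    | zero =>
      obtain rfl : N = m + 1 := by omega
      -- At m+1 = N the relation degenerates to a(N) = q, and both sides equal q/N, the weight of
      -- the single odd-even domino.
      have ha := hab (m + 1) (by omega) le_rfl
      rw [tileSum_closed_of_le _ _ _ _ _ le_rfl 0 _ _ _ rfl, kernelSum_of_le _ _ _ _ _ _ le_rfl, ha]
      simp only [tileSum, tileTerm, pairProd, kernelSum]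
      field_simp
      ring
    | succ t iht =>
      have hm1 : m + 1 < N := by omega
      have ha := hab (m + 1) (by omega) (by omega)
      have ih1 := iht (m + 1) hm1 (red x y [] _ hm1 (hz x (by simp)))
        (hz y (by simp) _ (by omega) (by omega)) (by omega)
      rw [← red x y [] _ hm1 (hz x (by simp))] at ih1
      have e2 : (N : K) - (m + 1 : ℕ) = (N - (m + 1) : ℕ) := by rw [Nat.cast_sub hm1.le]
      have hp : (N : K) - (m + 1 : ℕ) ≠ 0 := by rw [e2]; exact hN _ (by omega) (by omega)
      have hpx : (N : K) - (m + 1 : ℕ) - x ≠ 0 := by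
        rw [e2]; exact hz x (by simp) _ (by omega) (by omega)
      have h1 := tileSum_free_cons_step a b (q / N) N m hm1 x y [] hpx
      simp only [tileSum, add_zero, tileTerm, pairProd, kernelSum_nil] at h1 ih1 ⊢
      have ih2 : ((N : K) - (m + 1 : ℕ) - x) * (kernelSum a b (N + 1) [x, y] (m + 1) *
          (1 - 1 / (N : K) * y)) = (N - (m + 1 : ℕ)) *
          ((1 - 1 / (N : K) * (x + y)) * 1 * kernelSum a b N [x, y] (m + 1) + q / N * (1 * 1)) := by
        rw [← ih1]; field_simp
      -- The bracket equals -x(m+1-y)/N, so the pole at y cancels.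
      have key : (((N : K) - (m + 1 : ℕ) - x) * (1 - 1 / (N : K) * y) -
          (N - (m + 1 : ℕ)) * (1 - 1 / N * (x + y))) * (a (m + 1) / ((m + 1 : ℕ) - y)) =
          -x * a (m + 1) / N := by
        field_simp; ring
      apply mul_left_cancel₀ hpx
      linear_combination (1 + b (m + 1) * x) * ih2 - h1 + key - x / N * ha
  | succ k ih =>
    intro x y u hu hz m hm
    obtain ⟨x₂, y₂, u, rfl, hu'⟩ := exists_cons_cons hu
    obtain ⟨t, ht⟩ := Nat.exists_eq_add_of_lt hm
    have hN0 : (N : K) ≠ 0 := hN N (by omega) le_rfl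
    have hr := red x y (x₂ :: y₂ :: u) m hm (hz x (by simp))
    have hy : ((m + 1 : ℕ) : K) - y ≠ 0 := hz y (by simp) _ (by omega) (by omega)
    rw [mul_right_comm, hr, tileSum_free]
    induction t generalizing m with
    | zero =>
      obtain rfl : N = m + 1 := by omega
      rw [tileSum_closed_of_le _ _ _ _ _ le_rfl (k + 1) _ _ _ (by simp [hu']; omega),
        tileSum_closed_of_le _ _ _ _ _ le_rfl k _ _ _ hu',
        kernelSum_of_le _ _ _ _ _ _ le_rfl, kernelSum_of_le _ _ _ _ _ _ le_rfl]
      simp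
    | succ t iht =>
      have hm1 : m + 1 < N := by omega
      have ha := hab (m + 1) (by omega) (by omega)
      have ih1 := iht (m + 1) hm1 (by omega) (red x y _ _ hm1 (hz x (by simp)))
        (hz y (by simp) _ (by omega) (by omega))
      rw [← red x y _ _ hm1 (hz x (by simp))] at ih1
      have ih2 := ih x₂ y₂ u hu' (fun z hz' => hz z (by simp at hz' ⊢; tauto)) _ hm1
      have e2 : (N : K) - (m + 1 : ℕ) = (N - (m + 1) : ℕ) := by rw [Nat.cast_sub hm1.le]
      have hp : (N : K) - (m + 1 : ℕ) ≠ 0 := by rw [e2]; exact hN _ (by omega) (by omega)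
      have hpx : (N : K) - (m + 1 : ℕ) - x ≠ 0 := by
        rw [e2]; exact hz x (by simp) _ (by omega) (by omega)
      have hpx₂ : (N : K) - (m + 1 : ℕ) - x₂ ≠ 0 := by
        rw [e2]; exact hz x₂ (by simp) _ (by omega) (by omega)
      have h1 := tileSum_free_cons_step a b (q / N) N m hm1 x y (x₂ :: y₂ :: u) hpx
      obtain ⟨β, hβ⟩ := tileSum_closed_step a b (q / N) N m hN0 hm1 k y₂ u hu'
        (fun z hz' => hz z (by simp at hz' ⊢; tauto) _ (by omega) (by omega))
      -- The same β serves x and x₂, because both are followed by y₂ and u; cross-multiplying by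
      -- N-(m+1)-x₂ and N-(m+1)-x makes it drop out.
      have h2 := hβ x hpx
      have h3 := hβ x₂ hpx₂
      rw [tileSum_closed_cons_cons] at ih1 ⊢
      rw [tileSum_free (q / N) x₂ y₂ u (tileTerm a b N (m + 1))] at h1 ih2
      rw [pairProd] at ih1 ⊢
      have ih1' : ((N : K) - (m + 1 : ℕ) - x) *
          (kernelSum a b (N + 1) (x :: y :: x₂ :: y₂ :: u) (m + 1) *
          ((1 - 1 / (N : K) * (y + x₂)) * pairProd (1 / (N : K)) (y₂ :: u))) =
          (N - (m + 1 : ℕ)) * (tileSum (q / N) (x₂ :: y₂ :: u) .free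
            (fun v => tileTerm a b N (m + 1) (x :: y :: v)) -
            q / N * tileSum (q / N) (x :: y₂ :: u) .closed (tileTerm a b N (m + 1)) +
            q / N * tileSum (q / N) (x₂ :: y₂ :: u) .closed (tileTerm a b N (m + 1))) := by
        rw [← ih1]; field_simp
      have ih2' : ((N : K) - (m + 1 : ℕ) - x₂) * (pairProd (1 / (N : K)) (y₂ :: u) *
          kernelSum a b (N + 1) (x₂ :: y₂ :: u) (m + 1)) = (N - (m + 1 : ℕ)) *
          (tileSum (q / N) (x₂ :: y₂ :: u) .closed (tileTerm a b N (m + 1)) +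
            q / N * tileSum (q / N) u .closed (tileTerm a b N (m + 1))) := by
        rw [← ih2]; field_simp
      -- The bracket equals -(x-x₂)(m+1-y)/N. What is left over is a multiple of x-x₂, with
      -- coefficient proportional to q(1 + b(m+1)(N-(m+1))) - a(m+1), which vanishes by `ha`.
      have key : (((N : K) - (m + 1 : ℕ) - x) * (1 - 1 / (N : K) * (y + x₂)) -
          (N - (m + 1 : ℕ) - x₂) * (1 - 1 / N * (x + y))) * (a (m + 1) / ((m + 1 : ℕ) - y)) =
          -(x - x₂) * a (m + 1) / N := by
        field_simp; ring
      apply mul_left_cancel₀ hpx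
      apply mul_left_cancel₀ hpx₂
      linear_combination (1 + b (m + 1) * x) * (N - (m + 1 : ℕ) - x₂) * ih1' +
        (N - (m + 1 : ℕ) - x) * (a (m + 1) / ((m + 1 : ℕ) - y)) *
          (1 - 1 / (N : K) * (y + x₂)) * ih2' -
        (N - (m + 1 : ℕ) - x₂) * (h1 - q / N * h2) - (N - (m + 1 : ℕ) - x) * (q / N) * h3 +
        (N - (m + 1 : ℕ)) * (tileSum (q / N) (x₂ :: y₂ :: u) .closed (tileTerm a b N (m + 1)) +
            q / N * tileSum (q / N) u .closed (tileTerm a b N (m + 1))) * key -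
        (N - (m + 1 : ℕ)) * tileSum (q / N) (x₂ :: y₂ :: u) .closed (tileTerm a b N (m + 1)) *
          (x - x₂) / N * ha

end MainIdentity

/-! ### From the automaton to sums over subsets -/

section TileWeight

variable {ι K : Type*} [DecidableEq ι] [CommRing K]

/-- The weight with which the list that avoids `A` occurs in `tileSum`. -/
def tileWeight (δ : K) : List ι → TileState → Finset ι → K
  | [], .mid, _ => 0
  | [], .free, _ => 1
  | [], .closed, _ => 1
  | [_], _, _ => 0
  | i :: j :: u, .free, A =>
    if i ∈ A then (if j ∈ A then δ * tileWeight δ u .closed A else 0)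
    else if j ∈ A then tileWeight δ u .mid A else tileWeight δ u .free A
  | i :: j :: u, .closed, A =>
    if i ∈ A then 0
    else if j ∈ A then tileWeight δ u .mid A else tileWeight δ u .free A
  | i :: j :: u, .mid, A =>
    if i ∈ A then -δ * (if j ∈ A then tileWeight δ u .mid A else tileWeight δ u .free A) else 0

theorem tileWeight_congr (δ : K) {A B : Finset ι} : ∀ (u : List ι) (q : TileState),
    (∀ i ∈ u, i ∈ A ↔ i ∈ B) → tileWeight δ u q A = tileWeight δ u q B
  | [], .mid, _ => rfl
  | [], .free, _ => rfl
  | [], .closed, _ => rfl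
  | [_], _, _ => by simp [tileWeight]
  | i :: j :: u, q, h => by
    have hi := h i (by simp)
    have hj := h j (by simp)
    have hu := fun q => tileWeight_congr δ u q fun k hk => h k (by simp [hk])
    cases q <;> simp only [tileWeight, hi, hj, hu]

/-- The powerset splits into four according to which of i, j are removed, and each part is one
branch of the automaton. -/
theorem sum_tileWeight (δ : K) : ∀ (u : List ι) (q : TileState) (f : List ι → K), u.Nodup →
    ∑ A ∈ u.toFinset.powerset, tileWeight δ u q A * f (u.filter fun i => i ∉ A) =
      tileSum δ u q f
  | [], .mid, f, _ => by simp [tileWeight, tileSum]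
  | [], .free, f, _ => by simp [tileWeight, tileSum]
  | [], .closed, f, _ => by simp [tileWeight, tileSum]
  | [_], _, f, _ => by simp [tileWeight, tileSum]
  | i :: j :: u, q, f, h => by
    simp only [List.nodup_cons, List.mem_cons, not_or] at h
    obtain ⟨⟨hij, hi⟩, hj, hu⟩ := h
    have ih := fun q f => sum_tileWeight δ u q f hu
    have hw : ∀ A : Finset ι, ∀ q, tileWeight δ u q (insert i A) = tileWeight δ u q A :=
      fun A q => tileWeight_congr δ u q fun k hk => by
        simp [ne_of_mem_of_not_mem hk hi]
    have hw' : ∀ A : Finset ι, ∀ q, tileWeight δ u q (insert j A) = tileWeight δ u q A :=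
      fun A q => tileWeight_congr δ u q fun k hk => by
        simp [ne_of_mem_of_not_mem hk hj]
    have hf : ∀ A : Finset ι, (u.filter fun k => k ∉ insert i A) = u.filter fun k => k ∉ A :=
      fun A => List.filter_congr fun k hk => by
        simp [ne_of_mem_of_not_mem hk hi]
    have hf' : ∀ A : Finset ι, (u.filter fun k => k ∉ insert j A) = u.filter fun k => k ∉ A :=
      fun A => List.filter_congr fun k hk => by
        simp [ne_of_mem_of_not_mem hk hj]
    have hiA : ∀ A ∈ u.toFinset.powerset, i ∉ A := fun A hA hA' =>
      hi (by simpa using Finset.mem_powerset.1 hA hA')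
    have hjA : ∀ A ∈ u.toFinset.powerset, j ∉ A := fun A hA hA' =>
      hj (by simpa using Finset.mem_powerset.1 hA hA')
    have hij' : j ≠ i := Ne.symm hij
    rw [List.toFinset_cons, List.toFinset_cons, Finset.sum_powerset_insert (by simp [hij, hi]),
      Finset.sum_powerset_insert (by simp [hj]), Finset.sum_powerset_insert (by simp [hj])]
    have g0 : ∀ A ∈ u.toFinset.powerset, ((i :: j :: u).filter fun k => k ∉ A) =
        i :: j :: u.filter fun k => k ∉ A := fun A hA => by
      rw [List.filter_cons, List.filter_cons]; simp [hiA A hA, hjA A hA]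
    have g1 : ∀ A ∈ u.toFinset.powerset, ((i :: j :: u).filter fun k => k ∉ insert j A) =
        i :: u.filter fun k => k ∉ A := fun A hA => by
      rw [List.filter_cons, List.filter_cons, hf']; simp [hiA A hA, hij]
    have g2 : ∀ A ∈ u.toFinset.powerset, ((i :: j :: u).filter fun k => k ∉ insert i A) =
        j :: u.filter fun k => k ∉ A := fun A hA => by
      rw [List.filter_cons, List.filter_cons, hf]; simp [hjA A hA, hij']
    have g3 : ∀ A : Finset ι, ((i :: j :: u).filter fun k => k ∉ insert i (insert j A)) =
        u.filter fun k => k ∉ A := fun A => by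
      rw [List.filter_cons, List.filter_cons, hf, hf']; simp
    rw [← Finset.sum_add_distrib, ← Finset.sum_add_distrib, ← Finset.sum_add_distrib]
    cases q <;> simp only [tileSum, ← ih, ← Finset.sum_add_distrib, Finset.mul_sum] <;>
      refine Finset.sum_congr rfl fun A hA => ?_ <;>
      rw [g0 A hA, g1 A hA, g2 A hA, g3] <;>
      simp only [tileWeight, Finset.mem_insert, hw, hw', hiA A hA, hjA A hA, hij, hij', if_true,
        if_false, or_true, or_false] <;>
      ring

end TileWeight

/-! ### Local description of the tilings -/

theorem mem_EO {r : ℕ} {S : Finset ℕ} : S ∈ EO r ↔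
    ∃ R ⊆ Finset.Icc 1 (r - 1), ∀ i, i ∈ S ↔ ∃ j ∈ R, i = 2 * j ∨ i = 2 * j + 1 := by
  simp only [EO, Finset.mem_image, Finset.mem_powerset, Finset.ext_iff, Finset.mem_biUnion,
    Finset.mem_insert, Finset.mem_singleton]
  refine exists_congr fun R => and_congr_right fun _ => forall_congr' fun i => iff_comm

theorem mem_OE {r : ℕ} {S : Finset ℕ} : S ∈ OE r ↔
    ∃ R ⊆ Finset.Icc 1 r, ∀ i, i ∈ S ↔ ∃ j ∈ R, i = 2 * j - 1 ∨ i = 2 * j := by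
  simp only [OE, Finset.mem_image, Finset.mem_powerset, Finset.ext_iff, Finset.mem_biUnion,
    Finset.mem_insert, Finset.mem_singleton]
  refine exists_congr fun R => and_congr_right fun _ => forall_congr' fun i => iff_comm

/-- The local conditions that characterize `𝒯(r)`. -/
def IsTiled (A : Finset ℕ) : Prop :=
  ∀ j, (2 * j + 1 ∈ A → 2 * j ∈ A ∨ (2 * j + 2 ∈ A ∧ 2 * j + 3 ∉ A)) ∧
    (2 * j + 2 ∈ A → 2 * j + 3 ∈ A ∨ (2 * j + 1 ∈ A ∧ 2 * j ∉ A))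

/-- Membership becomes a condition on windows of four consecutive positions, which an automaton can
check. The decomposition is forced: an even-odd domino is present as soon as both its cells lie in
A, and an odd-even domino on 2j+1, 2j+2 can touch neither 2j nor 2j+3. -/
theorem mem_Tilings {r : ℕ} {A : Finset ℕ} :
    A ∈ Tilings r ↔ A ⊆ Finset.Icc 1 (2 * r) ∧ IsTiled A := by
  simp only [Tilings, Finset.mem_image, Finset.mem_filter, Finset.mem_product, Prod.exists,
    OEStar]
  constructor
  · rintro ⟨S, S', ⟨⟨hS, hS', hd⟩, hdis⟩, rfl⟩
    obtain ⟨R, hR, hS⟩ := mem_EO.1 hS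
    obtain ⟨R', hR', hS'⟩ := mem_OE.1 hS'
    have a1 : ∀ j, 2 * j ∈ S ↔ j ∈ R := fun j => by
      rw [hS]
      exact ⟨fun ⟨i, hi, h⟩ => by rwa [show j = i by omega], fun h => ⟨j, h, by omega⟩⟩
    have a2 : ∀ j, 2 * j + 1 ∈ S ↔ j ∈ R := fun j => by
      rw [hS]
      exact ⟨fun ⟨i, hi, h⟩ => by rwa [show j = i by omega], fun h => ⟨j, h, by omega⟩⟩
    have b1 : ∀ j, 2 * j + 1 ∈ S' ↔ j + 1 ∈ R' := fun j => by
      rw [hS']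
      exact ⟨fun ⟨i, hi, h⟩ => by rwa [show j + 1 = i by omega], fun h => ⟨j + 1, h, by omega⟩⟩
    have b2 : ∀ j, 2 * j ∈ S' ↔ j ∈ R' := fun j => by
      rw [hS']
      constructor
      · rintro ⟨i, hi, h⟩
        have := Finset.mem_Icc.1 (hR' hi)
        rwa [show j = i by omega]
      · exact fun h => ⟨j, h, by omega⟩
    have c1 : ∀ j, j ∈ R → j ∉ R' := fun j h h' =>
      Finset.disjoint_left.1 hdis ((a1 j).2 h) ((b2 j).2 h')
    have c2 : ∀ j, j ∈ R → j + 1 ∉ R' := fun j h h' =>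
      Finset.disjoint_left.1 hdis ((a2 j).2 h) ((b1 j).2 h')
    have c3 : ∀ j, j ∈ R' → j + 1 ∉ R' := fun j h h' =>
      hd _ ((b2 j).2 h) _ ((b2 _).2 h') (by push_cast; rw [abs_eq (by norm_num)]; right; ring)
    refine ⟨fun i hi => ?_, fun j => ?_⟩
    · rw [Finset.mem_union, hS, hS'] at hi
      rcases hi with ⟨j, hj, h⟩ | ⟨j, hj, h⟩
      · have := Finset.mem_Icc.1 (hR hj)
        rw [Finset.mem_Icc]; omega
      · have := Finset.mem_Icc.1 (hR' hj)
        rw [Finset.mem_Icc]; omega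
    · have e : 2 * j + 2 = 2 * (j + 1) := by ring
      have e' : 2 * j + 3 = 2 * (j + 1) + 1 := by ring
      simp only [Finset.mem_union, e, e', a1, a2, b1, b2]
      have h1 := c1 (j + 1)
      have h2 := c2 (j + 1)
      have h3 := c3 (j + 1)
      have h4 := c3 j
      have h5 := c2 j
      clear hS hS' a1 a2 b1 b2 c1 c2 c3 hd hdis hR hR'
      by_cases j ∈ R <;> by_cases j + 1 ∈ R <;> by_cases j ∈ R' <;> by_cases j + 1 ∈ R' <;>
        simp_all
  · rintro ⟨hA, h⟩
    have hA1 : ∀ i ∈ A, 1 ≤ i ∧ i ≤ 2 * r := fun i hi => Finset.mem_Icc.1 (hA hi)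
    let R := (Finset.Icc 1 (r - 1)).filter fun j => 2 * j ∈ A ∧ 2 * j + 1 ∈ A
    -- Two neighbouring even-odd dominoes also cover 2j-1 and 2j; the condition on 2j-2 excludes
    -- this.
    let R' := (Finset.Icc 1 r).filter fun j => 2 * j - 1 ∈ A ∧ 2 * j ∈ A ∧ 2 * j - 2 ∉ A
    refine ⟨R.biUnion fun j => {2 * j, 2 * j + 1}, R'.biUnion fun j => {2 * j - 1, 2 * j},
      ⟨⟨Finset.mem_image.2 ⟨R, by simp [R], rfl⟩,
        Finset.mem_image.2 ⟨R', by simp [R'], rfl⟩, ?_⟩, ?_⟩, ?_⟩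
    · simp only [Finset.mem_biUnion, Finset.mem_insert, Finset.mem_singleton, R',
        Finset.mem_filter, Finset.mem_Icc]
      rintro i ⟨j, ⟨hj, h1, h2, h3⟩, hi⟩ i' ⟨j', ⟨hj', h1', h2', h3'⟩, hi'⟩ hd
      rw [abs_eq (by norm_num)] at hd
      have : j = j' + 1 ∨ j' = j + 1 := by omega
      rcases this with rfl | rfl
      · exact h3 (by simpa [mul_add] using h2')
      · exact h3' (by simpa [mul_add] using h2)
    · rw [Finset.disjoint_left]
      simp only [Finset.mem_biUnion, Finset.mem_insert, Finset.mem_singleton, R, R',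
        Finset.mem_filter, Finset.mem_Icc]
      rintro i ⟨j, ⟨hj, h1, h2⟩, hi⟩ ⟨j', ⟨hj', h1', h2', h3'⟩, hi'⟩
      obtain ⟨t, rfl⟩ : ∃ t, j' = t + 1 := ⟨j' - 1, by omega⟩
      have e : 2 * (t + 1) - 1 = 2 * t + 1 := by omega
      have e' : 2 * (t + 1) - 2 = 2 * t := by omega
      rw [e] at h1' hi'
      rw [e'] at h3'
      have h4 := h t
      rcases hi with rfl | rfl
      · obtain rfl : j = t + 1 := by omega
        have e'' : 2 * (t + 1) + 1 = 2 * t + 3 := by ring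
        rw [e''] at h2
        tauto
      · obtain rfl : j = t := by omega
        tauto
    · ext i
      simp only [Finset.mem_union, Finset.mem_biUnion, Finset.mem_insert, Finset.mem_singleton,
        R, R', Finset.mem_filter, Finset.mem_Icc]
      constructor
      · rintro (⟨j, ⟨hj, h1, h2⟩, rfl | rfl⟩ | ⟨j', ⟨hj', h1', h2', h3'⟩, rfl | rfl⟩) <;> assumption
      · intro hi
        have hi1 := hA1 i hi
        rcases Nat.even_or_odd' i with ⟨j, rfl | rfl⟩
        · obtain ⟨t, rfl⟩ : ∃ t, j = t + 1 := ⟨j - 1, by omega⟩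
          rcases (h t).2 hi with h1 | h1
          · have := hA1 _ h1
            exact Or.inl ⟨t + 1, ⟨by omega, hi, h1⟩, by omega⟩
          · exact Or.inr ⟨t + 1, ⟨by omega, h1.1, hi, h1.2⟩, by omega⟩
        · by_cases h0 : 2 * j ∈ A
          · have := hA1 _ h0
            exact Or.inl ⟨j, ⟨by omega, h0, hi⟩, by omega⟩
          · have h1 := ((h j).1 hi).resolve_left h0
            have := hA1 _ h1.1
            exact Or.inr ⟨j + 1, ⟨by omega, hi, h1.1, h0⟩, by omega⟩

/-! ### The weight of a subset in the automaton -/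

section WeightFormula

variable {K : Type*} [CommRing K]

theorem range'_cons_cons (s t : ℕ) : List.range' (2 * s + 1) (2 * (t + 1)) =
    (2 * s + 1) :: (2 * s + 2) :: List.range' (2 * (s + 1) + 1) (2 * t) := by
  rw [show 2 * (t + 1) = 2 * t + 1 + 1 by ring, List.range'_succ, List.range'_succ]
  rfl

/-- A nonzero weight means that no dead branch is met. The state records whether position 2s was
removed and, if so, whether 2s+1 has to follow, which is the information needed for the window
around 2s+1 and 2s+2. -/
theorem isTiled_of_tileWeight_ne_zero (δ : K) {A : Finset ℕ} (t : ℕ) : ∀ (s : ℕ) (q : TileState),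
    A ⊆ Finset.Icc 1 (2 * (s + t)) → (q ≠ .free ↔ 2 * s ∈ A) →
    tileWeight δ (List.range' (2 * s + 1) (2 * t)) q A ≠ 0 →
    (q = .mid → 2 * s + 1 ∈ A) ∧ (q = .closed → 2 * s + 1 ∉ A) ∧
    ∀ j, s ≤ j → (2 * j + 1 ∈ A → 2 * j ∈ A ∨ (2 * j + 2 ∈ A ∧ 2 * j + 3 ∉ A)) ∧
      (2 * j + 2 ∈ A → 2 * j + 3 ∈ A ∨ (2 * j + 1 ∈ A ∧ 2 * j ∉ A)) := by
  induction t with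
  | zero =>
    intro s q hA hq hw
    have hA1 : ∀ i, 2 * s < i → i ∉ A := fun i hi hi' => by
      have := Finset.mem_Icc.1 (hA hi'); omega
    refine ⟨?_, fun _ => hA1 _ (by omega), fun j hj => ⟨fun h => absurd h (hA1 _ (by omega)),
      fun h => absurd h (hA1 _ (by omega))⟩⟩
    rintro rfl
    simp [tileWeight] at hw
  | succ t ih =>
    intro s q hA hq hw
    rw [range'_cons_cons, show 2 * (s + 1) + 1 = 2 * s + 3 by ring] at hw
    have ih' := fun q => ih (s + 1) q (by rwa [show s + 1 + t = s + (t + 1) by ring])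
    have step : ∀ P : ℕ → Prop, P s → (∀ j, s + 1 ≤ j → P j) → ∀ j, s ≤ j → P j := by
      intro P h1 h2 j hj
      rcases hj.eq_or_lt with rfl | h
      · exact h1
      · exact h2 j h
    have e : 2 * (s + 1) = 2 * s + 2 := by ring
    simp only [e, show 2 * s + 2 + 1 = 2 * s + 3 by ring] at ih'
    by_cases h1 : 2 * s + 1 ∈ A <;> by_cases h2 : 2 * s + 2 ∈ A <;> cases q <;>
      simp only [tileWeight, h1, h2, if_true, if_false, ne_eq, not_true] at hw
    · have H := ih' .closed (by simp [h2]) fun h => hw (by rw [h, mul_zero])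
      have := H.2.1 rfl
      simp at hq
      refine ⟨by simp, by simp, step _ (by tauto) H.2.2⟩
    · have H := ih' .mid (by simp [h2]) fun h => hw (by rw [h, mul_zero])
      have := H.1 rfl
      simp at hq
      refine ⟨by simp [h1], by simp, step _ (by tauto) H.2.2⟩
    · have H := ih' .free (by simp [h2]) fun h => hw (by rw [h, mul_zero])
      simp at hq
      refine ⟨by simp [h1], by simp, step _ (by tauto) H.2.2⟩
    · have H := ih' .mid (by simp [h2]) hw
      have := H.1 rfl
      refine ⟨by simp, by simp, step _ (by tauto) H.2.2⟩
    · have H := ih' .mid (by simp [h2]) hw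
      have := H.1 rfl
      refine ⟨by simp, by simp [h1], step _ (by tauto) H.2.2⟩
    · have H := ih' .free (by simp [h2]) hw
      refine ⟨by simp, by simp, step _ (by tauto) H.2.2⟩
    · have H := ih' .free (by simp [h2]) hw
      refine ⟨by simp, by simp [h1], step _ (by tauto) H.2.2⟩

/-- The state of the automaton after the first `2 s` positions of a tiling. -/
def stateAt (A : Finset ℕ) (s : ℕ) : TileState :=
  if 2 * s ∈ A then if 2 * s + 1 ∈ A then .mid else .closed else .free

/-- `1` if an even-odd domino straddles position `2 s`. -/
def pending (A : Finset ℕ) (s : ℕ) : ℕ := if 2 * s ∈ A ∧ 2 * s + 1 ∈ A then 1 else 0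

/-- An even-odd domino is charged when its second half is read. A pending one therefore has one cell
outside the remaining range, and `pending` restores that cell before the count is halved. -/
theorem tileWeight_of_isTiled (δ : K) {A : Finset ℕ} (h : IsTiled A) (t : ℕ) : ∀ s,
    A ⊆ Finset.Icc 1 (2 * (s + t)) →
    tileWeight δ (List.range' (2 * s + 1) (2 * t)) (stateAt A s) A =
      (-1) ^ (∑ j ∈ Finset.Ico s (s + t), pending A j) *
        δ ^ ((∑ i ∈ Finset.Ico (2 * s + 1) (2 * (s + t) + 1), (if i ∈ A then 1 else 0) +
          pending A s) / 2) := by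
  induction t with
  | zero =>
    intro s hA
    have hA1 : 2 * s + 1 ∉ A := fun hi' => by
      have := Finset.mem_Icc.1 (hA hi'); omega
    by_cases h0 : 2 * s ∈ A <;> simp [stateAt, hA1, pending, h0, tileWeight]
  | succ t ih =>
    intro s hA
    have ih := ih (s + 1) (by rwa [show s + 1 + t = s + (t + 1) by ring])
    have e : 2 * (s + 1) = 2 * s + 2 := by ring
    have hP : ∑ j ∈ Finset.Ico s (s + (t + 1)), pending A j =
        pending A s + ∑ j ∈ Finset.Ico (s + 1) (s + (t + 1)), pending A j :=
      Finset.sum_eq_sum_Ico_succ_bot (by omega) _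
    have hQ : ∑ i ∈ Finset.Ico (2 * s + 1) (2 * (s + (t + 1)) + 1), (if i ∈ A then 1 else 0) =
        (if 2 * s + 1 ∈ A then 1 else 0) + ((if 2 * s + 2 ∈ A then 1 else 0) +
          ∑ i ∈ Finset.Ico (2 * s + 2 + 1) (2 * (s + (t + 1)) + 1), (if i ∈ A then 1 else 0)) := by
      rw [Finset.sum_eq_sum_Ico_succ_bot (by omega), Finset.sum_eq_sum_Ico_succ_bot (by omega)]
    rw [range'_cons_cons, hP, hQ]
    rw [show s + 1 + t = s + (t + 1) by ring, e] at ih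
    generalize ∑ j ∈ Finset.Ico (s + 1) (s + (t + 1)), pending A j = P at *
    generalize ∑ i ∈ Finset.Ico (2 * s + 2 + 1) (2 * (s + (t + 1)) + 1),
      (if i ∈ A then 1 else 0) = Q at *
    rw [e]
    have h' := h s
    simp only [stateAt, pending, e] at ih ⊢
    by_cases h0 : 2 * s ∈ A <;> by_cases h1 : 2 * s + 1 ∈ A <;> by_cases h2 : 2 * s + 2 ∈ A <;>
      by_cases h3 : 2 * s + 3 ∈ A <;>
      simp only [h0, h1, h2, h3, if_true, if_false, true_and, and_true, and_false, false_and,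
        tileWeight, show 2 * s + 2 + 1 = 2 * s + 3 by ring] at ih ⊢ h' <;>
      first
      -- These windows contradict the tiling condition at s.
      | (simp at h'; done)
      | (rw [ih]
         try simp only [zero_add, add_zero]
         first
         | done
         | (rw [show (1 + (1 + Q)) / 2 = Q / 2 + 1 by omega]; ring)
         | (rw [show (1 + (1 + Q) + 1) / 2 = (Q + 1) / 2 + 1 by omega]; ring)
         | (rw [show (1 + Q + 1) / 2 = Q / 2 + 1 by omega]; ring)
         | (rw [show (1 + Q) / 2 = (Q + 1) / 2 by omega]))

end WeightFormula

theorem eo_eq_card {r : ℕ} {S : Finset ℕ} (hS : S ⊆ Finset.Icc 1 (2 * r)) :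
    eo S = ∑ j ∈ Finset.Ico 0 r, pending S j := by
  rw [eo, Finset.card_filter]
  simp only [pending, ← Finset.sum_filter]
  congr 1
  ext j
  simp only [Finset.mem_filter, Finset.mem_Icc, Finset.mem_Ico]
  constructor
  · rintro ⟨_, h1, h2⟩
    have := Finset.mem_Icc.1 (hS h2)
    exact ⟨by omega, h1, h2⟩
  · rintro ⟨_, h1, h2⟩
    have := Finset.mem_Icc.1 (hS h1)
    have := Finset.le_sup (f := id) h1
    simp only [id] at this
    exact ⟨by omega, h1, h2⟩

section

variable {K : Type*} [CommRing K]

theorem tileWeight_eq (δ : K) {r : ℕ} {A : Finset ℕ} (hA : A ⊆ Finset.Icc 1 (2 * r)) :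
    tileWeight δ (List.range' 1 (2 * r)) .free A =
      if A ∈ Tilings r then (-1) ^ eo A * δ ^ kappa A else 0 := by
  have h0 : 2 * 0 ∉ A := fun h => by simpa using hA h
  split_ifs with h
  · have := tileWeight_of_isTiled δ (mem_Tilings.1 h).2 r 0 (by simpa using hA)
    have hs : stateAt A 0 = .free := by rw [stateAt, if_neg h0]
    have hp : pending A 0 = 0 := by rw [pending, if_neg fun h' => h0 h'.1]
    rw [hs, hp, zero_add, ← eo_eq_card hA, ← Finset.sum_filter, ← Finset.card_eq_sum_ones] at this
    rw [show 1 = 2 * 0 + 1 by rfl, this, kappa]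
    rw [add_zero]
    congr 4
    ext i
    simp only [Finset.mem_filter, Finset.mem_Ico]
    constructor
    · exact fun h => h.2
    · intro h
      have := Finset.mem_Icc.1 (hA h)
      exact ⟨by omega, h⟩
  · by_contra hw
    have := isTiled_of_tileWeight_ne_zero δ r 0 .free (by simpa using hA)
      (by simpa using h0) hw
    exact h (mem_Tilings.2 ⟨hA, fun j => this.2.2 j (Nat.zero_le _)⟩)

/-- The sum over `𝒯(r)` as a transfer sum. -/
theorem sum_Tilings (δ : K) (r : ℕ) (f : List ℕ → K) :
    ∑ A ∈ Tilings r, (-1) ^ eo A * δ ^ kappa A * f ((List.range' 1 (2 * r)).filter fun i => i ∉ A) =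
      tileSum δ (List.range' 1 (2 * r)) .free f := by
  rw [← sum_tileWeight δ _ _ _ (List.nodup_range' ..)]
  have e : (List.range' 1 (2 * r)).toFinset = Finset.Icc 1 (2 * r) := by
    ext i; simp; omega
  rw [e]
  refine Finset.sum_subset_zero_on_sdiff
    (fun A hA => Finset.mem_powerset.2 (mem_Tilings.1 hA).1) (fun A hA => ?_) fun A hA => ?_
  · rw [Finset.mem_sdiff, Finset.mem_powerset] at hA
    rw [tileWeight_eq δ hA.1, if_neg hA.2, zero_mul]
  · rw [tileWeight_eq δ (mem_Tilings.1 hA).1, if_pos hA]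

end

/-! ### Sums over sets that contain no consecutive pair of a list -/

section NoPair

variable {ι : Type*}

/-- No two entries with positions `2 t, 2 t + 1` (counted from `0`) both lie in `B`. -/
def noPair : List ι → Finset ι → Prop
  | [], _ => True
  | [_], _ => True
  | i :: j :: u, B => ¬(i ∈ B ∧ j ∈ B) ∧ noPair u B

theorem noPair_iff : ∀ (u : List ι) (B : Finset ι),
    noPair u B ↔ ∀ t (h : 2 * t + 1 < u.length), ¬(u[2 * t] ∈ B ∧ u[2 * t + 1] ∈ B)
  | [], _ => by simp [noPair]
  | [_], _ => by simp [noPair]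
  | i :: j :: u, B => by
    rw [noPair, noPair_iff u B]
    constructor
    · rintro ⟨h0, h⟩ t ht
      cases t with
      | zero => exact h0
      | succ t => exact h t (by simp at ht; omega)
    · intro h
      exact ⟨h 0 (by simp), fun t ht => h (t + 1) (by simp; omega)⟩

theorem noPair_congr {A B : Finset ι} (u : List ι) (h : ∀ i ∈ u, i ∈ A ↔ i ∈ B) :
    noPair u A ↔ noPair u B := by
  rw [noPair_iff, noPair_iff]
  refine forall_congr' fun t => forall_congr' fun ht => ?_
  rw [h _ (List.getElem_mem _), h _ (List.getElem_mem _)]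

variable {R : Type*} [CommRing R] [DecidableEq ι]

instance decidableNoPair : ∀ (u : List ι) (B : Finset ι), Decidable (noPair u B)
  | [], _ => isTrue trivial
  | [_], _ => isTrue trivial
  | i :: j :: u, B =>
    have := decidableNoPair u B
    inferInstanceAs (Decidable (¬(i ∈ B ∧ j ∈ B) ∧ noPair u B))

/-- Each factor 1 - t(z_i + z_j) selects neither index, i or j, but never both. -/
theorem sum_noPair (t : R) (z : ι → R) : ∀ u : List ι, u.Nodup →
    ∑ B ∈ u.toFinset.powerset with noPair u B, ∏ i ∈ B, (-t * z i) = pairProd t (u.map z)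
  | [], _ => by
    rw [Finset.filter_true_of_mem fun _ _ => by trivial]; simp [pairProd]
  | [i], _ => by
    rw [Finset.filter_true_of_mem fun _ _ => by trivial]
    have := Finset.sum_powerset_insert (Finset.notMem_empty i) fun B => ∏ i ∈ B, (-t * z i)
    simp at this
    simp [pairProd, this, sub_eq_add_neg]
  | i :: j :: u, h => by
    simp only [List.nodup_cons, List.mem_cons, not_or] at h
    obtain ⟨⟨hij, hi⟩, hj, hu⟩ := h
    have hiA : ∀ A ∈ u.toFinset.powerset, i ∉ A := fun A hA hA' =>
      hi (by simpa using Finset.mem_powerset.1 hA hA')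
    have hjA : ∀ A ∈ u.toFinset.powerset, j ∉ A := fun A hA hA' =>
      hj (by simpa using Finset.mem_powerset.1 hA hA')
    have hw : ∀ A : Finset ι, noPair u (insert i A) ↔ noPair u A :=
      fun A => noPair_congr u fun k hk => by simp [ne_of_mem_of_not_mem hk hi]
    have hw' : ∀ A : Finset ι, noPair u (insert j A) ↔ noPair u A :=
      fun A => noPair_congr u fun k hk => by simp [ne_of_mem_of_not_mem hk hj]
    rw [List.map_cons, List.map_cons, pairProd, ← sum_noPair t z u hu, Finset.sum_filter,
      List.toFinset_cons, List.toFinset_cons, Finset.sum_powerset_insert (by simp [hij, hi]),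
      Finset.sum_powerset_insert (by simp [hj]), Finset.sum_powerset_insert (by simp [hj]),
      ← Finset.sum_add_distrib, ← Finset.sum_add_distrib, ← Finset.sum_add_distrib,
      Finset.sum_filter, Finset.mul_sum]
    refine Finset.sum_congr rfl fun A hA => ?_
    have hij' : j ≠ i := Ne.symm hij
    rw [Finset.prod_insert (hjA A hA), Finset.prod_insert (hiA A hA)]
    simp only [noPair, hw, hw', Finset.mem_insert, hiA A hA, hjA A hA, hij, hij', or_true,
      or_false, and_true, and_false, not_true, not_false_eq_true, true_and, false_and, if_false]
    split_ifs <;> ring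

end NoPair

theorem eo_eq_zero_iff {S : Finset ℕ} : eo S = 0 ↔ ∀ j, 1 ≤ j → ¬(2 * j ∈ S ∧ 2 * j + 1 ∈ S) := by
  rw [eo, Finset.card_eq_zero, Finset.filter_eq_empty_iff]
  constructor
  · intro h j hj h'
    have := Finset.le_sup (f := id) h'.1
    simp only [id] at this
    exact h (Finset.mem_Icc.2 ⟨hj, by omega⟩) h'
  · exact fun h j hj => h j (Finset.mem_Icc.1 hj).1

theorem oe_eq_zero_iff {S : Finset ℕ} : oe S = 0 ↔ ∀ j, ¬(2 * j + 1 ∈ S ∧ 2 * j + 2 ∈ S) := by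
  rw [oe, Finset.card_eq_zero, Finset.filter_eq_empty_iff]
  constructor
  · intro h j h'
    have := Finset.le_sup (f := id) h'.2
    simp only [id] at this
    exact h (Finset.mem_Icc.2 ⟨by omega, by omega⟩ : j + 1 ∈ _) h'
  · intro h j hj h'
    obtain ⟨t, rfl⟩ : ∃ t, j = t + 1 := ⟨j - 1, by have := (Finset.mem_Icc.1 hj).1; omega⟩
    exact h t h'

theorem eo_eq_zero_iff_noPair {r : ℕ} {B : Finset ℕ} (hB : B ⊆ Finset.Icc 1 (2 * r)) :
    eo B = 0 ↔ noPair (List.range' 2 (2 * r - 1)) B := by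
  rw [eo_eq_zero_iff, noPair_iff]
  constructor
  · intro h t ht
    have := h (t + 1) (by omega)
    simpa [mul_add, add_comm, add_left_comm, add_assoc] using this
  · intro h j hj h'
    have := Finset.mem_Icc.1 (hB h'.2)
    have := h (j - 1) (by simp; omega)
    simp only [List.getElem_range'] at this
    exact this ⟨by convert h'.1 using 1; omega, by convert h'.2 using 1; omega⟩

theorem sigma_eq_length (A : Finset ℕ) (n : ℕ) :
    sigma A n = ((List.range' 1 n).filter fun i => i ∉ A).length := by
  have h := List.toFinset_card_of_nodup
    ((List.nodup_range' (s := 1) (n := n) (step := 1)).filter fun i => i ∉ A)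
  rw [← h, sigma]
  congr 1
  ext i
  simp
  omega

/-- σ_A is the position, counted from 1, in the list of survivors; so oe(σ_A(B)) = 0 is the
condition `noPair` on that list. -/
theorem map_sigma (A : Finset ℕ) (n : ℕ) :
    ((List.range' 1 n).filter fun i => i ∉ A).map (sigma A) =
      List.range' 1 ((List.range' 1 n).filter fun i => i ∉ A).length := by
  induction n with
  | zero => simp
  | succ n ih =>
    rw [List.range'_concat, List.filter_append, List.map_append, ih, List.length_append,
      ← List.range'_append]
    congr 1
    by_cases h : n + 1 ∈ A
    · simp [h, add_comm 1 n]
    · have := sigma_eq_length A (n + 1)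
      rw [List.range'_concat, List.filter_append, List.length_append] at this
      simp [h, add_comm 1 n] at this ⊢
      omega

theorem oe_eq_zero_iff_noPair {n : ℕ} {A B : Finset ℕ} (hB : B ⊆ Finset.Icc 1 n \ A) :
    oe (B.image (sigma A)) = 0 ↔ noPair ((List.range' 1 n).filter fun i => i ∉ A) B := by
  have hs := map_sigma A n
  set u := (List.range' 1 n).filter fun i => i ∉ A with hu
  have hmem : ∀ i ∈ B, i ∈ u := fun i hi => by
    have := hB hi
    simp at this
    simp [hu, this]
    omega
  have hget : ∀ p (h : p < u.length), sigma A u[p] = p + 1 := fun p h => by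
    have : (u.map (sigma A))[p]'(by simpa using h) = p + 1 := by
      simp only [hs]
      simp [add_comm]
    simpa using this
  have key : ∀ p, p + 1 ∈ B.image (sigma A) ↔ ∃ h : p < u.length, u[p] ∈ B := by
    intro p
    rw [Finset.mem_image]
    constructor
    · rintro ⟨i, hi, h⟩
      obtain ⟨q, hq, rfl⟩ := List.getElem_of_mem (hmem i hi)
      rw [hget] at h
      obtain rfl : q = p := by omega
      exact ⟨hq, hi⟩
    · rintro ⟨h, h'⟩
      exact ⟨_, h', hget p h⟩
  rw [oe_eq_zero_iff, noPair_iff]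
  refine forall_congr' fun t => ?_
  rw [key, key (2 * t + 1)]
  constructor
  · exact fun h ht h' => h ⟨⟨by omega, h'.1⟩, ⟨ht, h'.2⟩⟩
  · rintro h ⟨⟨_, h1⟩, ⟨h2, h3⟩⟩
    exact h h2 ⟨h1, h3⟩

/-! ### The finite sums as coefficients -/

/-- The sum over a row with `t + 1` entries greater than `m`, whose last entry `n` has
weight `φ n`. -/
def rowSum (b : ℕ → ℚ) (N : ℕ) (φ : ℕ → ℚ) : ℕ → ℕ → ℚ
  | 0, m => ∑ n ∈ Finset.Ioo m N, φ n
  | t + 1, m => ∑ n ∈ Finset.Ioo m N,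
      (1 / ((N : ℚ) - n) * rowSum b N φ t (n - 1) + b n * rowSum b N φ t n)

/-- The sum over arrays with entries in `(m, N)` whose shape is `l_1, k_1, …, l_r, k_r`. -/
def coeffSum (a b : ℕ → ℚ) (N : ℕ) : List ℕ → ℕ → ℚ
  | [], _ => 1
  | [_], _ => 0
  | l :: k :: c, m =>
    rowSum b N (fun n => a n * (1 / (n : ℚ) ^ k * coeffSum a b N c n)) (l - 1) m

theorem rowSum_of_le (b : ℕ → ℚ) (N : ℕ) (φ : ℕ → ℚ) (t : ℕ) {m : ℕ} (h : N ≤ m + 1) :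
    rowSum b N φ t m = 0 := by
  cases t <;> rw [rowSum] <;>
  · refine Finset.sum_eq_zero fun n hn => ?_
    have := Finset.mem_Ioo.1 hn
    omega

theorem rowSum_zero_step (b : ℕ → ℚ) (N : ℕ) (φ : ℕ → ℚ) {m : ℕ} (h : m + 1 < N) :
    rowSum b N φ 0 m = rowSum b N φ 0 (m + 1) + φ (m + 1) := by
  rw [rowSum, rowSum, Ioo_eq_insert h, Finset.sum_insert (by simp), add_comm]

theorem rowSum_succ_step (b : ℕ → ℚ) (N : ℕ) (φ : ℕ → ℚ) (t : ℕ) {m : ℕ} (h : m + 1 < N) :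
    rowSum b N φ (t + 1) m = rowSum b N φ (t + 1) (m + 1) +
      (1 / ((N : ℚ) - (m + 1 : ℕ)) * rowSum b N φ t m +
        b (m + 1) * rowSum b N φ t (m + 1)) := by
  rw [rowSum, rowSum, Ioo_eq_insert h, Finset.sum_insert (by simp), add_comm, Nat.add_sub_cancel]

/-- The power series in the variables with indices in `u` and coefficients `F`. -/
noncomputable def ser (F : List ℕ → ℚ) (u : List ℕ) : MvPowerSeries ℕ ℚ :=
  fun d => if d.support ⊆ u.toFinset then F (u.map fun i => d i + 1) else 0

theorem coeff_ser (F : List ℕ → ℚ) (u : List ℕ) (d : ℕ →₀ ℕ) :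
    MvPowerSeries.coeff d (ser F u) =
      if d.support ⊆ u.toFinset then F (u.map fun i => d i + 1) else 0 := rfl

theorem coeff_X_mul (i : ℕ) (f : MvPowerSeries ℕ ℚ) (d : ℕ →₀ ℕ) :
    MvPowerSeries.coeff d (MvPowerSeries.X i * f) =
      if d i = 0 then 0 else MvPowerSeries.coeff (d - Finsupp.single i 1) f := by
  rw [MvPowerSeries.X, MvPowerSeries.coeff_monomial_mul, one_mul]
  simp only [Finsupp.single_le_iff, Nat.one_le_iff_ne_zero, ite_not]

theorem coeff_X_mul_ser (F : List ℕ → ℚ) {i : ℕ} {u : List ℕ} (hi : i ∉ u) (d : ℕ →₀ ℕ) :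
    MvPowerSeries.coeff d (MvPowerSeries.X i * ser F (i :: u)) =
      if d.support ⊆ (i :: u).toFinset ∧ d i ≠ 0 then F (d i :: u.map fun j => d j + 1) else 0 := by
  rw [coeff_X_mul]
  by_cases h0 : d i = 0
  · simp [h0]
  · have hs : (d - Finsupp.single i 1).support ⊆ (i :: u).toFinset ↔
        d.support ⊆ (i :: u).toFinset := by
      simp only [Finset.subset_iff, Finsupp.mem_support_iff, List.mem_toFinset]
      refine forall_congr' fun j => ?_
      rcases eq_or_ne j i with rfl | hj
      · simp
      · simp [hj.symm]
    rw [coeff_ser, if_neg h0]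
    simp only [hs, h0, ne_eq, not_false_eq_true, and_true]
    congr 1
    rw [List.map_cons]
    congr 2
    · simp; omega
    · refine List.map_congr_left fun j hj => ?_
      simp [(ne_of_mem_of_not_mem hj hi).symm]

theorem coeff_ser_cons (F : List ℕ → ℚ) (i : ℕ) (u : List ℕ) (d : ℕ →₀ ℕ) :
    MvPowerSeries.coeff d (ser F (i :: u)) =
      if d.support ⊆ (i :: u).toFinset then F ((d i + 1) :: u.map fun j => d j + 1) else 0 := by
  rw [coeff_ser, List.map_cons]

theorem support_subset_cons_iff {i : ℕ} {u : List ℕ} (hi : i ∉ u) (d : ℕ →₀ ℕ) :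
    d.support ⊆ u.toFinset ↔ d.support ⊆ (i :: u).toFinset ∧ d i = 0 := by
  simp only [Finset.subset_iff, Finsupp.mem_support_iff, List.mem_toFinset, List.mem_cons]
  constructor
  · intro h
    exact ⟨fun j hj => Or.inr (h hj), by by_contra h'; exact hi (h h')⟩
  · rintro ⟨h, h0⟩ j hj
    exact (h hj).resolve_left fun e => hj (e ▸ h0)

theorem coeff_ser_of_notMem (F : List ℕ → ℚ) {i : ℕ} {u : List ℕ} (hi : i ∉ u) (d : ℕ →₀ ℕ) :
    MvPowerSeries.coeff d (ser F u) =
      if d.support ⊆ (i :: u).toFinset ∧ d i = 0 then F (u.map fun j => d j + 1) else 0 := by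
  simp only [coeff_ser, support_subset_cons_iff hi]

/-- This is the counterpart of `kernelSum_step`, checked coefficient by coefficient on the recursion
of `rowSum` in m. -/
theorem ser_row_step (a b : ℕ → ℚ) (N : ℕ) {m i j : ℕ} {u : List ℕ} (hi : i ∉ j :: u)
    (h : m + 1 < N) :
    (MvPowerSeries.C ((N : ℚ) - (m + 1 : ℕ)) - MvPowerSeries.X i) *
        ser (fun c => coeffSum a b N c m) (i :: j :: u) =
      MvPowerSeries.C ((N : ℚ) - (m + 1 : ℕ)) *
        ((1 + MvPowerSeries.C (b (m + 1)) * MvPowerSeries.X i) *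
          ser (fun c => coeffSum a b N c (m + 1)) (i :: j :: u) +
        MvPowerSeries.C (a (m + 1)) *
          ser (fun c => 1 / ((m + 1 : ℕ) : ℚ) ^ (c.headD 0) * coeffSum a b N c.tail (m + 1))
            (j :: u)) := by
  have hp : (N : ℚ) - (m + 1 : ℕ) ≠ 0 := by
    rw [← Nat.cast_sub h.le]; exact Nat.cast_ne_zero.2 (by omega)
  have hr := fun φ t => rowSum_succ_step b N φ t h
  generalize (N : ℚ) - (m + 1 : ℕ) = p at hp hr ⊢
  ext d
  simp only [sub_mul, add_mul, one_mul, mul_assoc, map_sub, map_add, MvPowerSeries.coeff_C_mul,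
    coeff_X_mul_ser _ hi, coeff_ser_cons _ i,
    coeff_ser_of_notMem _ hi]
  by_cases hs : d.support ⊆ (i :: j :: u).toFinset
  -- Exponent 0 of the row variable means a row with one entry, where the source term contributes;
  -- for positive exponents the source has no coefficient, as it does not involve this variable.
  · rcases hd : d i with _ | t
    · simp only [hs, ne_eq, not_true, and_false, if_false, if_true, and_true, List.map_cons,
        coeffSum, List.headD_cons, List.tail_cons, zero_add, Nat.sub_self, mul_zero]
      rw [rowSum_zero_step _ _ _ h]
      ring
    · simp only [hs, ne_eq, Nat.succ_ne_zero, not_false_eq_true, and_true, if_true, and_false,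
        if_false, List.map_cons, coeffSum, Nat.add_sub_cancel]
      rw [hr]
      field_simp
      ring
  · simp only [hs, false_and, if_false, mul_zero, sub_self, add_zero]

/-- The geometric series 1/(m - X_j) = ∑ X_j^{k-1}/m^k, with the denominator cleared. -/
theorem ser_power_step (a b : ℕ → ℚ) (N : ℕ) {m j : ℕ} {u : List ℕ} (hj : j ∉ u) (hm : m ≠ 0) :
    (MvPowerSeries.C (m : ℚ) - MvPowerSeries.X j) *
        ser (fun c => 1 / (m : ℚ) ^ (c.headD 0) * coeffSum a b N c.tail m) (j :: u) =
      ser (fun c => coeffSum a b N c m) u := by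
  have hm' : (m : ℚ) ≠ 0 := Nat.cast_ne_zero.2 hm
  ext d
  simp only [sub_mul, map_sub, MvPowerSeries.coeff_C_mul, coeff_X_mul_ser _ hj, coeff_ser_cons _ j,
    coeff_ser_of_notMem _ hj]
  by_cases hs : d.support ⊆ (j :: u).toFinset
  · rcases hd : d j with _ | t
    · simp [hm']
    · simp only [hs, ne_eq, Nat.succ_ne_zero, not_false_eq_true, and_true, if_true, and_false,
        if_false, List.headD_cons, List.tail_cons]
      rw [pow_succ (m : ℚ) (t + 1)]
      field_simp
      ring
  · simp only [hs, false_and, if_false, mul_zero, sub_self]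

/-- The field of fractions of the power series ring in countably many variables. -/
abbrev SerField : Type := FractionRing (MvPowerSeries ℕ ℚ)

/-- The embedding of the power series ring into its field of fractions. -/
noncomputable abbrev toField : MvPowerSeries ℕ ℚ →+* SerField :=
  algebraMap (MvPowerSeries ℕ ℚ) SerField

theorem toField_injective : Function.Injective toField := IsFractionRing.injective _ _

/-- The image of a rational number. -/
noncomputable abbrev const : ℚ →+* SerField := toField.comp MvPowerSeries.C

/-- The image of a variable. -/
noncomputable abbrev var (i : ℕ) : SerField := toField (MvPowerSeries.X i)

theorem natCast_sub_var_ne_zero {n : ℕ} (hn : n ≠ 0) (i : ℕ) : (n : SerField) - var i ≠ 0 := by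
  have : (n : SerField) - var i = toField ((n : MvPowerSeries ℕ ℚ) - MvPowerSeries.X i) := by simp
  rw [this, map_ne_zero_iff _ toField_injective]
  intro h
  have := congrArg MvPowerSeries.constantCoeff h
  simp at this
  exact hn this

/-- Both sides satisfy the same recursion in m and agree for m ≥ N-1, so descending induction on m
applies. The fraction field is there because `kernelSum` divides by linear forms in the variables.
-/
theorem toField_ser (a b : ℕ → ℚ) (N : ℕ) : ∀ (u : List ℕ), u.Nodup → ∀ m,
    toField (ser (fun c => coeffSum a b N c m) u) =
      kernelSum (fun n => const (a n)) (fun n => const (b n)) N (u.map var) m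
  | [], _, m => by
    rw [List.map_nil, kernelSum_nil, ← map_one toField]
    congr 1
    ext d
    rw [coeff_ser, MvPowerSeries.coeff_one]
    simp [coeffSum]
  | [i], _, m => by
    simp only [List.map_cons, List.map_nil, kernelSum]
    rw [← map_zero toField]
    congr 1
    ext d
    rw [coeff_ser]
    simp [coeffSum]
  | i :: j :: u, hu, m => by
    obtain ⟨hi, hu⟩ := List.nodup_cons.1 hu
    obtain ⟨hj, hu⟩ := List.nodup_cons.1 hu
    have hbase : ∀ m, N ≤ m + 1 → toField (ser (fun c => coeffSum a b N c m) (i :: j :: u)) =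
        kernelSum (fun n => const (a n)) (fun n => const (b n)) N ((i :: j :: u).map var) m := by
      intro m hm
      rw [List.map_cons, List.map_cons, kernelSum_of_le _ _ _ _ _ _ hm, ← map_zero toField]
      congr 1
      ext d
      rw [coeff_ser]
      simp [coeffSum, rowSum_of_le _ _ _ _ hm]
    obtain ⟨t, ht⟩ : ∃ t, N ≤ m + t + 1 := ⟨N, by omega⟩
    induction t generalizing m with
    | zero => exact hbase m ht
    | succ t iht =>
      rcases Nat.lt_or_ge (m + 1) N with hm | hm
      swap
      · exact hbase m hm
      have hp : (N : SerField) - (m + 1 : ℕ) - var i ≠ 0 := by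
        rw [← Nat.cast_sub hm.le]
        exact natCast_sub_var_ne_zero (by omega) i
      have hy : ((m + 1 : ℕ) : SerField) - var j ≠ 0 := natCast_sub_var_ne_zero (by omega) j
      have h1 := congrArg toField (ser_row_step a b N (m := m) hi hm)
      have h2 := congrArg toField (ser_power_step a b N (m := m + 1) hj (by omega))
      have h3 := kernelSum_step (fun n => const (a n)) (fun n => const (b n)) N (var i) (var j)
        (u.map var) hm hp
      rw [List.map_cons, List.map_cons]
      rw [← List.map_cons (f := var), ← List.map_cons (f := var), ← iht (m + 1) (by omega),
        ← toField_ser a b N u hu] at h3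
      simp only [map_mul, map_add, map_sub, map_one, map_natCast] at h1 h2
      rw [← h2] at h3
      apply mul_left_cancel₀ hp
      refine h1.trans (Eq.trans ?_ h3.symm)
      simp only [RingHom.comp_apply]
      field_simp

/-! ### Extraction of coefficients -/

theorem reduceFrom_eq (A B : Finset ℕ) (c : List ℕ) : ∀ s, reduceFrom s c A B =
    ((List.range' s c.length).filter fun i => i ∉ A).map fun i =>
      c.getD (i - s) 0 - if i ∈ B then 1 else 0 := by
  induction c with
  | nil => intro s; simp [reduceFrom]
  | cons a c ih =>
    intro s
    have : ∀ i ∈ (List.range' (s + 1) c.length).filter (fun i => i ∉ A),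
        (a :: c).getD (i - s) 0 = c.getD (i - (s + 1)) 0 := by
      intro i hi
      have h := (List.mem_range'_1.1 (List.mem_filter.1 hi).1).1
      rw [show i - s = (i - (s + 1)) + 1 by omega, List.getD_cons_succ]
    rw [reduceFrom_cons, ih, List.length_cons, List.range'_succ, List.filter_cons]
    have h2 : ((List.range' (s + 1) c.length).filter fun i => i ∉ A).map (fun i =>
        (a :: c).getD (i - s) 0 - if i ∈ B then 1 else 0) =
      ((List.range' (s + 1) c.length).filter fun i => i ∉ A).map fun i =>
        c.getD (i - (s + 1)) 0 - if i ∈ B then 1 else 0 :=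
      List.map_congr_left fun i hi => by rw [this i hi]
    by_cases hA : s ∈ A
    · simp [hA]
      simpa using h2.symm
    · by_cases hB : s ∈ B <;> simp [hA, hB] <;> simpa using h2.symm

/-- The exponents `c_i - 1`, the entry with position `i` (counted from `1`) belonging to the `i`-th
variable. -/
noncomputable def expo (c : List ℕ) : ℕ →₀ ℕ :=
  Finsupp.onFinset (Finset.Icc 1 c.length)
    (fun i => if i = 0 then 0 else c.getD (i - 1) 0 - 1) fun i hi => by
      rw [Finset.mem_Icc]
      by_contra h
      apply hi
      rcases Nat.eq_zero_or_pos i with h0 | h0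
      · simp [h0]
      · rw [List.getD_eq_default _ _ (by omega)]; simp

theorem expo_apply {c : List ℕ} {i : ℕ} (hi : i ≠ 0) : expo c i = c.getD (i - 1) 0 - 1 := by
  simp [expo, hi]

theorem prod_X (B : Finset ℕ) : ∏ i ∈ B, (MvPowerSeries.X i : MvPowerSeries ℕ ℚ) =
    MvPowerSeries.monomial (∑ i ∈ B, Finsupp.single i 1) 1 := by
  induction B using Finset.induction_on with
  | empty => simp
  | insert i B hi ih =>
    rw [Finset.prod_insert hi, Finset.sum_insert hi, ih, MvPowerSeries.X,
      MvPowerSeries.monomial_mul_monomial, one_mul]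

theorem sum_single_apply (B : Finset ℕ) (i : ℕ) :
    (∑ j ∈ B, Finsupp.single j 1 : ℕ →₀ ℕ) i = if i ∈ B then 1 else 0 := by
  rw [Finsupp.finsetSum_apply]
  simp [Finsupp.single_apply]

/-- The monomial over B lowers the exponents in B, which needs c_i > 1 there; the variables of A are
absent from the series, which needs c_i = 1 on A. The exponents that survive describe c_{A,B}. -/
theorem coeff_prod_X_mul_ser (F : List ℕ → ℚ) {c : List ℕ} (hc : ∀ i ∈ c, 1 ≤ i) {A B : Finset ℕ}
    (hA : A ⊆ Finset.Icc 1 c.length) (hB : B ⊆ Finset.Icc 1 c.length \ A) :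
    MvPowerSeries.coeff (expo c) ((∏ i ∈ B, MvPowerSeries.X i) *
      ser F ((List.range' 1 c.length).filter fun i => i ∉ A)) =
      if A ⊆ onePos c ∧ B ⊆ gtPos c then F (reduce c A B) else 0 := by
  have hget : ∀ i ∈ Finset.Icc 1 c.length, 1 ≤ c.getD (i - 1) 0 := fun i hi => by
    have := Finset.mem_Icc.1 hi
    rw [List.getD_eq_getElem _ _ (by omega)]
    exact hc _ (List.getElem_mem _)
  have hB' : ∀ i ∈ B, i ∈ Finset.Icc 1 c.length ∧ i ∉ A := fun i hi => Finset.mem_sdiff.1 (hB hi)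
  rw [prod_X, MvPowerSeries.coeff_monomial_mul, one_mul, coeff_ser]
  have h1 : (∑ j ∈ B, Finsupp.single j 1 ≤ expo c) ↔ B ⊆ gtPos c := by
    constructor
    · intro h i hi
      have hi' := (hB' i hi).1
      have h' := h i
      rw [sum_single_apply, if_pos hi, expo_apply (by have := Finset.mem_Icc.1 hi'; omega)] at h'
      exact Finset.mem_filter.2 ⟨hi', by omega⟩
    · intro h i
      rw [sum_single_apply]
      split_ifs with hi
      · have := Finset.mem_filter.1 (h hi)
        rw [expo_apply (by have := Finset.mem_Icc.1 this.1; omega)]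
        omega
      · exact Nat.zero_le _
  have h2 : B ⊆ gtPos c → ((expo c - ∑ j ∈ B, Finsupp.single j 1).support ⊆
      ((List.range' 1 c.length).filter fun i => i ∉ A).toFinset ↔ A ⊆ onePos c) := by
    intro hBc
    constructor
    · intro h i hi
      have hi' := hA hi
      refine Finset.mem_filter.2 ⟨hi', ?_⟩
      have hiB : i ∉ B := fun h' => (hB' i h').2 hi
      have : i ∉ (expo c - ∑ j ∈ B, Finsupp.single j 1).support := fun h' => by
        have := h h'
        simp [hi] at this
      rw [Finsupp.notMem_support_iff, Finsupp.tsub_apply, sum_single_apply, if_neg hiB,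
        expo_apply (by have := Finset.mem_Icc.1 hi'; omega)] at this
      have := hget i hi'
      omega
    · intro h i hi
      rw [Finsupp.mem_support_iff, Finsupp.tsub_apply] at hi
      have hi' : i ∈ Finset.Icc 1 c.length := by
        have : i ∈ (expo c).support := by rw [Finsupp.mem_support_iff]; omega
        exact Finsupp.support_onFinset_subset this
      have hi0 := Finset.mem_Icc.1 hi'
      have hiA : i ∉ A := fun hiA => by
        have := (Finset.mem_filter.1 (h hiA)).2
        rw [expo_apply (by omega), this] at hi
        simp at hi
      simp [hiA]
      omega
  by_cases hBc : B ⊆ gtPos c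
  · rw [if_pos (h1.2 hBc)]
    simp only [h2 hBc, hBc, and_true]
    split_ifs with hAc
    · congr 1
      rw [reduce, reduceFrom_eq]
      refine List.map_congr_left fun i hi => ?_
      have hi1 := List.mem_range'_1.1 (List.mem_filter.1 hi).1
      have hi2 := hget i (Finset.mem_Icc.2 (by omega))
      rw [Finsupp.tsub_apply, sum_single_apply, expo_apply (by omega)]
      split_ifs with hiB
      · have := (Finset.mem_filter.1 (hBc hiB)).2
        omega
      · omega
    · rfl
  · rw [if_neg (fun h => hBc (h1.1 h)), if_neg (fun h => hBc h.2)]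

theorem toField_prod (t : ℚ) (B : Finset ℕ) :
    toField (MvPowerSeries.C ((-t) ^ B.card) * ∏ i ∈ B, MvPowerSeries.X i) =
      ∏ i ∈ B, (-const t * var i) := by
  rw [Finset.prod_mul_distrib, Finset.prod_const, map_mul, map_prod]
  simp only [map_pow, map_neg, RingHom.comp_apply]

/-- Position 1 belongs to no pair {2j, 2j+1} with j ≥ 1, hence the separate factor; the other pairs
are the consecutive ones of the list 2, …, 2r, with 2r left single. -/
theorem sum_eo {R : Type*} [CommRing R] (t : R) (z : ℕ → R) {r : ℕ} (hr : 1 ≤ r) :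
    ∑ B ∈ (Finset.Icc 1 (2 * r)).powerset with eo B = 0, ∏ i ∈ B, (-t * z i) =
      (1 - t * z 1) * pairProd t ((List.range' 2 (2 * r - 1)).map z) := by
  have h1 : Finset.Icc 1 (2 * r) = insert 1 (List.range' 2 (2 * r - 1)).toFinset := by
    ext i; simp; omega
  have h2 : (1 : ℕ) ∉ (List.range' 2 (2 * r - 1)).toFinset := by simp
  have h3 : ∀ B : Finset ℕ, noPair (List.range' 2 (2 * r - 1)) (insert 1 B) ↔
      noPair (List.range' 2 (2 * r - 1)) B := fun B => noPair_congr _ fun i hi => by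
    have := List.mem_range'_1.1 hi
    rw [Finset.mem_insert, or_iff_right (by omega)]
  rw [← sum_noPair t z _ (List.nodup_range' ..), Finset.filter_congr fun B hB =>
    eo_eq_zero_iff_noPair (Finset.mem_powerset.1 hB), h1, Finset.sum_filter,
    Finset.sum_powerset_insert h2, Finset.sum_filter, ← Finset.sum_add_distrib, Finset.mul_sum]
  refine Finset.sum_congr rfl fun B hB => ?_
  rw [Finset.prod_insert fun h => h2 (Finset.mem_powerset.1 hB h)]
  simp only [h3]
  split_ifs <;> ring

/-- The difference equation in `N` of the finite sums. -/
theorem coeffSum_succ (a b : ℕ → ℚ) (q : ℚ) {N r : ℕ} (hN : 1 ≤ N) (hr : 1 ≤ r)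
    (hab : ∀ m : ℕ, 1 ≤ m → m ≤ N → a m = q * (1 + b m * (N - m)))
    {c : List ℕ} (hc : ∀ i ∈ c, 1 ≤ i) (hlen : c.length = 2 * r) :
    ∑ B ∈ (gtPos c).powerset with eo B = 0,
        (-(1 / (N : ℚ))) ^ B.card * coeffSum a b (N + 1) (reduce c ∅ B) 0 =
      ∑ p ∈ (onePos c).powerset ×ˢ (gtPos c).powerset with
          p.1 ∈ Tilings r ∧ oe (p.2.image (sigma p.1)) = 0,
        (-1) ^ eo p.1 * (q / N) ^ kappa p.1 * ((-(1 / (N : ℚ))) ^ p.2.card *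
          coeffSum a b N (reduce c p.1 p.2) 0) := by
  set u := List.range' 1 (2 * r) with hu
  set t := 1 / (N : ℚ) with ht
  have hund : u.Nodup := List.nodup_range' ..
  have hmain : ∑ B ∈ (Finset.Icc 1 (2 * r)).powerset with eo B = 0,
      MvPowerSeries.C ((-t) ^ B.card) * ((∏ i ∈ B, MvPowerSeries.X i) *
        ser (fun c => coeffSum a b (N + 1) c 0) (u.filter fun i => i ∉ (∅ : Finset ℕ))) =
      ∑ A ∈ Tilings r, ∑ B ∈ (Finset.Icc 1 (2 * r) \ A).powerset with
          oe (B.image (sigma A)) = 0,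
        MvPowerSeries.C ((-1) ^ eo A * (q / N) ^ kappa A) * (MvPowerSeries.C ((-t) ^ B.card) *
          ((∏ i ∈ B, MvPowerSeries.X i) *
            ser (fun c => coeffSum a b N c 0) (u.filter fun i => i ∉ A))) := by
    apply toField_injective
    have hcast : const t = 1 / (N : SerField) := by rw [ht, map_div₀]; simp
    have hcons : u.map var = var 1 :: var 2 :: (List.range' 3 (2 * (r - 1))).map var := by
      rw [hu, show 2 * r = 2 * (r - 1) + 1 + 1 by omega, List.range'_succ, List.range'_succ]
      rfl
    have hcons' : (List.range' 2 (2 * r - 1)).map var =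
        var 2 :: (List.range' 3 (2 * (r - 1))).map var := by
      rw [show 2 * r - 1 = 2 * (r - 1) + 1 by omega, List.range'_succ]
      rfl
    -- The identity is used at m = 0, where 1 - x_1/(N-m) becomes the free factor 1 - x_1/N of
    -- position 1 in `sum_eo`.
    have hk := kernelSum_succ_eq_tileSum (fun n => const (a n)) (fun n => const (b n)) (const q) N
      (fun n hn _ => by
        rw [← map_natCast const, map_ne_zero_iff _ const.injective]
        exact Nat.cast_ne_zero.2 (by omega))
      (fun m hm hm' => by 
        rw [hab m hm hm']
        simp only [map_mul, map_add, map_one, map_sub, map_natCast]) (r - 1) (var 1) (var 2)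
      ((List.range' 3 (2 * (r - 1))).map var) (by simp)
      (fun z hz n hn _ => by
        rw [← hcons] at hz
        obtain ⟨i, -, rfl⟩ := List.mem_map.1 hz
        exact natCast_sub_var_ne_zero (by omega) i) 0 (by omega)
    rw [← hcons, ← hcons', Nat.cast_zero, sub_zero, ← toField_ser a b _ u hund, ← tileSum_map,
      ← hcast, ← sum_Tilings] at hk
    rw [map_sum, map_sum]
    refine Eq.trans ?_ (hk.trans ?_)
    · rw [← one_div_mul_eq_div, ← hcast, ← sum_eo _ _ hr, Finset.sum_mul]
      refine Finset.sum_congr rfl fun B _ => ?_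
      rw [← mul_assoc, map_mul, toField_prod]
      simp
    · refine Finset.sum_congr rfl fun A hA => ?_
      have hnd : (u.filter fun i => i ∉ A).Nodup := hund.filter _
      have hset : (u.filter fun i => i ∉ A).toFinset = Finset.Icc 1 (2 * r) \ A := by
        ext i; simp [hu]; omega
      rw [map_sum, tileTerm, ← toField_ser a b N _ hnd, ← hcast, ← sum_noPair _ _ _ hnd, hset,
        Finset.filter_congr fun B hB => oe_eq_zero_iff_noPair (Finset.mem_powerset.1 hB),
        Finset.sum_mul, Finset.mul_sum]
      refine Finset.sum_congr rfl fun B _ => ?_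
      rw [← mul_assoc (MvPowerSeries.C ((-t) ^ B.card)),
        map_mul toField (MvPowerSeries.C ((-1) ^ eo A * (q / N) ^ kappa A)),
        map_mul toField (MvPowerSeries.C ((-t) ^ B.card) * _), toField_prod]
      congr 1
      rw [← RingHom.comp_apply]
      simp only [map_mul, map_pow, map_neg, map_one, map_div₀, map_natCast]
  have hcoeff := congrArg (MvPowerSeries.coeff (expo c)) hmain
  simp only [map_sum, MvPowerSeries.coeff_C_mul] at hcoeff
  have hgt : gtPos c ⊆ Finset.Icc 1 (2 * r) := hlen ▸ Finset.filter_subset _ _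
  have hone : onePos c ⊆ Finset.Icc 1 (2 * r) := hlen ▸ Finset.filter_subset _ _
  have hdisj : ∀ A ⊆ onePos c, gtPos c ⊆ Finset.Icc 1 (2 * r) \ A := by
    intro A hA i hi
    refine Finset.mem_sdiff.2 ⟨hgt hi, fun h => ?_⟩
    have h1 := (Finset.mem_filter.1 (hA h)).2
    have h2 := (Finset.mem_filter.1 hi).2
    omega
  have hL : ∀ B ∈ (Finset.Icc 1 (2 * r)).powerset,
      MvPowerSeries.coeff (expo c) ((∏ i ∈ B, MvPowerSeries.X i) *
        ser (fun c => coeffSum a b (N + 1) c 0) (u.filter fun i => i ∉ (∅ : Finset ℕ))) =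
      if B ∈ (gtPos c).powerset then coeffSum a b (N + 1) (reduce c ∅ B) 0 else 0 := by
    intro B hB
    have := coeff_prod_X_mul_ser (fun c => coeffSum a b (N + 1) c 0) hc (A := ∅) (B := B)
      (by simp) (by simpa [hlen] using hB)
    rw [hlen] at this
    simpa using this
  have hR : ∀ A ∈ Tilings r, ∀ B ∈ (Finset.Icc 1 (2 * r) \ A).powerset,
      MvPowerSeries.coeff (expo c) ((∏ i ∈ B, MvPowerSeries.X i) *
        ser (fun c => coeffSum a b N c 0) (u.filter fun i => i ∉ A)) =
      if A ⊆ onePos c ∧ B ⊆ gtPos c then coeffSum a b N (reduce c A B) 0 else 0 := by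
    intro A hA B hB
    have := coeff_prod_X_mul_ser (fun c => coeffSum a b N c 0) hc (A := A) (B := B)
      (by rw [hlen]; exact (mem_Tilings.1 hA).1) (by rw [hlen]; exact Finset.mem_powerset.1 hB)
    rwa [hlen] at this
  refine Eq.trans ?_ (hcoeff.trans ?_)
  · rw [Finset.sum_congr rfl fun B hB => congrArg _ (hL B (Finset.mem_filter.1 hB).1)]
    simp only [mul_ite, mul_zero]
    rw [← Finset.sum_filter]
    refine Finset.sum_congr (Finset.ext fun B => ?_) fun _ _ => rfl
    simp only [Finset.mem_filter, Finset.mem_powerset]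
    exact ⟨fun h => ⟨⟨h.1.trans hgt, h.2⟩, h.1⟩, fun h => ⟨h.2, h.1.2⟩⟩
  · have hA : ∀ A ∈ Tilings r, ∑ B ∈ (Finset.Icc 1 (2 * r) \ A).powerset with
          oe (B.image (sigma A)) = 0,
        (-1) ^ eo A * (q / N) ^ kappa A * ((-t) ^ B.card *
          MvPowerSeries.coeff (expo c) ((∏ i ∈ B, MvPowerSeries.X i) *
            ser (fun c => coeffSum a b N c 0) (u.filter fun i => i ∉ A))) =
        if A ∈ (onePos c).powerset then
          ∑ B ∈ (gtPos c).powerset with oe (B.image (sigma A)) = 0,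
            (-1) ^ eo A * (q / N) ^ kappa A * ((-t) ^ B.card *
              coeffSum a b N (reduce c A B) 0) else 0 := by
      intro A hA
      rw [Finset.sum_congr rfl fun B hB => by rw [hR A hA B (Finset.mem_filter.1 hB).1]]
      split_ifs with h
      · rw [Finset.mem_powerset] at h
        simp only [h, true_and, mul_ite, mul_zero]
        rw [← Finset.sum_filter]
        refine Finset.sum_congr (Finset.ext fun B => ?_) fun _ _ => rfl
        simp only [Finset.mem_filter, Finset.mem_powerset]
        exact ⟨fun h' => ⟨h'.2, h'.1.2⟩, fun h' => ⟨⟨h'.1.trans (hdisj A h), h'.2⟩, h'.1⟩⟩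
      · rw [Finset.mem_powerset] at h
        simp [h]
    rw [Finset.sum_congr rfl hA, ← Finset.sum_filter, Finset.filter_mem_eq_inter,
      Finset.inter_comm, ← Finset.filter_mem_eq_inter, Finset.sum_filter, Finset.sum_filter,
      Finset.sum_product]
    refine Finset.sum_congr rfl fun A _ => ?_
    split_ifs with h
    · simp only [h, true_and, Finset.sum_filter]
    · simp only [h, false_and, if_false, Finset.sum_const_zero]

/-! ### The sums `ζ_N(l; k)` -/

/-- `ζ_N(l; k)` restricted to arrays with entries greater than `m`. -/
def binomFrom (N m : ℕ) {r : ℕ} (l k : Fin r → ℕ) : ℚ :=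
  ∑ n ∈ (Fintype.piFinset fun j : Fin r =>
        Fintype.piFinset fun _ : Fin (l j) => Finset.Ioo m N) with
      (∀ j : Fin r, ∀ a b : Fin (l j), a ≤ b → n j a ≤ n j b) ∧
      (∀ j j' : Fin r, j < j' → ∀ (a : Fin (l j)) (b : Fin (l j')), n j a < n j' b),
    ∏ j, ∏ i : Fin (l j),
      if (i : ℕ) + 1 = l j then 1 / (n j i : ℚ) ^ k j else 1 / ((N : ℚ) - (n j i : ℚ))

/-- The first entry n is split off; the weak inequality for the rest of the row is the strict bound
by n-1. -/
theorem sum_row (N : ℕ) (ψ G : ℕ → ℚ) (t : ℕ) : ∀ m,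
    ∑ u ∈ (Fintype.piFinset fun _ : Fin (t + 1) => Finset.Ioo m N) with
        ∀ a b : Fin (t + 1), a ≤ b → u a ≤ u b,
      (∏ i : Fin (t + 1), if (i : ℕ) + 1 = t + 1 then ψ (u i) else 1 / ((N : ℚ) - (u i : ℚ))) *
        G (u (Fin.last t)) =
      rowSum (fun _ => 0) N (fun n => ψ n * G n) t m := by
  induction t with
  | zero =>
    intro m
    rw [rowSum]
    refine Finset.sum_bij' (fun u _ => u 0) (fun n _ _ => n) ?_ ?_ ?_ ?_ ?_
    · intro u hu
      exact Fintype.mem_piFinset.1 (Finset.mem_filter.1 hu).1 0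
    · intro n hn
      rw [Finset.mem_filter, Fintype.mem_piFinset]
      exact ⟨fun _ => hn, fun _ _ _ => le_rfl⟩
    · intro u _
      ext i
      rw [Fin.fin_one_eq_zero i]
    · intros; rfl
    · intro u _
      simp
  | succ t ih =>
    intro m
    rw [rowSum]
    simp only [zero_mul, add_zero]
    simp only [← ih, Finset.mul_sum]
    rw [Finset.sum_sigma']
    refine Finset.sum_bij' (fun u _ => ⟨u 0, Fin.tail u⟩) (fun p _ => Fin.cons p.1 p.2)
      ?_ ?_ ?_ ?_ ?_
    · intro u hu
      obtain ⟨h1, h2⟩ := Finset.mem_filter.1 hu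
      rw [Fintype.mem_piFinset] at h1
      refine Finset.mem_sigma.2 ⟨h1 0, Finset.mem_filter.2 ⟨Fintype.mem_piFinset.2 fun i => ?_,
        fun a b hab => h2 _ _ (Fin.succ_le_succ_iff.2 hab)⟩⟩
      have h3 := Finset.mem_Ioo.1 (h1 0)
      have h4 := Finset.mem_Ioo.1 (h1 i.succ)
      have h5 := h2 0 i.succ (Fin.zero_le _)
      rw [Finset.mem_Ioo]
      simp only [Fin.tail]
      omega
    · rintro ⟨n, u⟩ hp
      obtain ⟨h0, h1⟩ := Finset.mem_sigma.1 hp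
      obtain ⟨h1, h2⟩ := Finset.mem_filter.1 h1
      rw [Fintype.mem_piFinset] at h1
      simp only [Finset.mem_Ioo] at h0 h1
      refine Finset.mem_filter.2 ⟨Fintype.mem_piFinset.2 fun i => ?_, fun a b hab => ?_⟩
      · rw [Finset.mem_Ioo]
        refine Fin.cases ?_ (fun i => ?_) i
        · simpa using h0
        · have := h1 i
          simp only [Fin.cons_succ]
          omega
      · revert hab
        refine Fin.cases ?_ (fun a => ?_) a <;> refine Fin.cases ?_ (fun b => ?_) b
        · intro; rfl
        · intro
          have := h1 b
          simp only [Fin.cons_succ, Fin.cons_zero]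
          omega
        · intro h; exact absurd h (by simp)
        · intro h
          simpa using h2 a b (Fin.succ_le_succ_iff.1 h)
    · intro u _
      simp
    · rintro ⟨n, u⟩ _
      simp
    · intro u _
      rw [Fin.prod_univ_succ]
      simp [Fin.tail, mul_assoc, ← Fin.succ_last]

theorem sum_row_of_pos (N : ℕ) (ψ G : ℕ → ℚ) {L : ℕ} (hL : 1 ≤ L) (m : ℕ) :
    ∑ u ∈ (Fintype.piFinset fun _ : Fin L => Finset.Ioo m N) with
        ∀ a b : Fin L, a ≤ b → u a ≤ u b,
      (∏ i : Fin L, if (i : ℕ) + 1 = L then ψ (u i) else 1 / ((N : ℚ) - (u i : ℚ))) *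
        G (u ⟨L - 1, by omega⟩) =
      rowSum (fun _ => 0) N (fun n => ψ n * G n) (L - 1) m := by
  obtain ⟨t, rfl⟩ : ∃ t, L = t + 1 := ⟨L - 1, by omega⟩
  exact sum_row N ψ G t m

theorem binomFrom_succ (N : ℕ) {r : ℕ} (l k : Fin (r + 1) → ℕ) (h0 : 1 ≤ l 0) (m : ℕ) :
    binomFrom N m l k =
      ∑ u ∈ (Fintype.piFinset fun _ : Fin (l 0) => Finset.Ioo m N) with
        ∀ a b : Fin (l 0), a ≤ b → u a ≤ u b,
      (∏ i : Fin (l 0), if (i : ℕ) + 1 = l 0 then 1 / (u i : ℚ) ^ k 0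
          else 1 / ((N : ℚ) - (u i : ℚ))) *
        binomFrom N (u ⟨l 0 - 1, by omega⟩) (fun j => l j.succ) (fun j => k j.succ) := by
  simp only [binomFrom, Finset.mul_sum]
  rw [Finset.sum_sigma']
  refine Finset.sum_bij' (fun n _ => ⟨n 0, fun j => n j.succ⟩)
    (fun p _ => Fin.cons (α := fun j => Fin (l j) → ℕ) p.1 p.2) ?_ ?_ ?_ ?_ ?_
  · intro n hn
    obtain ⟨h1, h2, h3⟩ := Finset.mem_filter.1 hn
    simp only [Fintype.mem_piFinset] at h1
    refine Finset.mem_sigma.2 ⟨Finset.mem_filter.2 ⟨Fintype.mem_piFinset.2 (h1 0), h2 0⟩,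
      Finset.mem_filter.2 ⟨Fintype.mem_piFinset.2 fun j => Fintype.mem_piFinset.2 fun i => ?_,
        fun j => h2 _, fun j j' hj => h3 _ _ (Fin.succ_lt_succ_iff.2 hj)⟩⟩
    exact Finset.mem_Ioo.2 ⟨h3 _ _ (Fin.succ_pos _) _ _, (Finset.mem_Ioo.1 (h1 _ _)).2⟩
  · rintro ⟨u, n⟩ hp
    obtain ⟨h0', h1⟩ := Finset.mem_sigma.1 hp
    obtain ⟨h0', h4⟩ := Finset.mem_filter.1 h0'
    obtain ⟨h1, h2, h3⟩ := Finset.mem_filter.1 h1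
    simp only [Fintype.mem_piFinset, Finset.mem_Ioo] at h0' h1
    -- The last entry is the largest of its row, so it alone bounds the later rows.
    have hlast : ∀ a, u a ≤ u ⟨l 0 - 1, by omega⟩ := fun a => h4 _ _ (by
      rw [Fin.le_def]; have := a.2; simp only; omega)
    refine Finset.mem_filter.2 ⟨Fintype.mem_piFinset.2 fun j => Fintype.mem_piFinset.2 fun i => ?_,
      fun j => ?_, fun j j' hj => ?_⟩
    · rw [Finset.mem_Ioo]
      revert i
      refine Fin.cases ?_ (fun j => ?_) j
      · exact h0'
      · intro i
        have := h1 j i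
        have := h0' ⟨l 0 - 1, by omega⟩
        simp only [Fin.cons_succ]
        omega
    · refine Fin.cases ?_ (fun j => ?_) j
      · exact h4
      · exact h2 j
    · revert hj
      refine Fin.cases ?_ (fun j => ?_) j <;> refine Fin.cases ?_ (fun j' => ?_) j'
      · intro h; exact absurd h (lt_irrefl _)
      · intro _ a b
        exact (hlast a).trans_lt (h1 j' b).1
      · intro h; exact absurd h (by simp)
      · intro h
        exact h3 j j' (Fin.succ_lt_succ_iff.1 h)
  · intro n _
    funext j
    refine Fin.cases ?_ (fun j => ?_) j <;> rfl
  · rintro ⟨u, n⟩ _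
    rfl
  · intro n _
    rw [Fin.prod_univ_succ]

theorem binomFrom_eq (N : ℕ) {r : ℕ} : ∀ (l k : Fin r → ℕ), (∀ j, 1 ≤ l j) → ∀ m,
    binomFrom N m l k = coeffSum (fun _ => 1) (fun _ => 0) N
      (List.ofFn fun j => [l j, k j]).flatten m := by
  induction r with
  | zero => intro l k _ m; simp [binomFrom, coeffSum]
  | succ r ih =>
    intro l k hl m
    rw [binomFrom_succ N l k (hl 0)]
    simp only [ih _ _ fun j : Fin r => hl j.succ]
    rw [List.ofFn_succ, List.flatten_cons, List.cons_append, List.singleton_append, coeffSum]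
    simpa only [one_mul] using sum_row_of_pos N (fun n => 1 / (n : ℚ) ^ k 0)
      (fun n => coeffSum (fun _ => 1) (fun _ => 0) N
        (List.ofFn fun j : Fin r => [l j.succ, k j.succ]).flatten n) (hl 0) m

/-! ### The sums `ζ_N^◇(k)` -/

/-- The summand of `ζ_N^◇(k)` belonging to `A`, restricted to entries greater than `m`. -/
def diamondTerm (N m : ℕ) {r : ℕ} (k : Fin r → ℕ) (A : Finset (Fin r)) : ℚ :=
  ∑ n ∈ (Fintype.piFinset fun _ : Fin r => Finset.Ioo m N) with
        ∀ i j : Fin r, (i : ℕ) + 1 = j → n i ≤ n j ∧ (i ∉ A → n i < n j),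
      (∏ i ∈ A, 1 / ((N : ℚ) - (n i : ℚ))) * ∏ i ∈ Aᶜ, 1 / (n i : ℚ) ^ k i

/-- `ζ_N^◇(k)` restricted to entries greater than `m`. -/
def diamondFrom (N m : ℕ) (k : List ℕ) : ℚ :=
  ∑ A ∈ (Finset.univ.filter fun i : Fin k.length => k.get i = 1).powerset,
    diamondTerm N m k.get A

theorem prod_mul_prod_compl {r : ℕ} (A : Finset (Fin r)) (f g : Fin r → ℚ) :
    (∏ i ∈ A, f i) * ∏ i ∈ Aᶜ, g i = ∏ i, if i ∈ A then f i else g i := by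
  rw [Finset.prod_ite]
  congr 2 <;> ext i <;> simp

theorem diamondTerm_succ (N m : ℕ) {r : ℕ} (k : Fin (r + 1) → ℕ) (A : Finset (Fin (r + 1)))
    (A' : Finset (Fin r)) (hA : ∀ i, i.succ ∈ A ↔ i ∈ A') :
    diamondTerm N m k A = ∑ n ∈ Finset.Ioo m N,
      (if 0 ∈ A then 1 / ((N : ℚ) - n) else 1 / (n : ℚ) ^ k 0) *
        diamondTerm N (if 0 ∈ A then n - 1 else n) (fun i => k i.succ) A' := by
  simp only [diamondTerm, Finset.mul_sum]
  rw [Finset.sum_sigma']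
  refine Finset.sum_bij' (fun u _ => ⟨u 0, Fin.tail u⟩) (fun p _ => Fin.cons p.1 p.2)
      ?_ ?_ ?_ ?_ ?_
  · intro u hu
    obtain ⟨h1, h2⟩ := Finset.mem_filter.1 hu
    simp only [Fintype.mem_piFinset, Finset.mem_Ioo] at h1
    refine Finset.mem_sigma.2 ⟨Finset.mem_Ioo.2 (h1 0),
      Finset.mem_filter.2 ⟨Fintype.mem_piFinset.2 fun i => ?_, fun i j hij => ?_⟩⟩
    · rw [Finset.mem_Ioo]
      refine ⟨?_, (h1 _).2⟩
      -- Only neighbouring entries are compared, so the lower bound set by the first entry has to be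
      -- propagated along the tail.
      have : ∀ t (ht : t < r), (if 0 ∈ A then u 0 - 1 else u 0) < u (Fin.succ ⟨t, ht⟩) := by
        intro t
        induction t with
        | zero =>
          intro ht
          have := h2 0 (Fin.succ ⟨0, ht⟩) (by simp)
          have := h1 0
          split_ifs with h0
          · omega
          · tauto
        | succ t ih =>
          intro ht
          exact (ih (by omega)).trans_le
            (h2 (Fin.succ ⟨t, by omega⟩) (Fin.succ ⟨t + 1, ht⟩) (by simp)).1
      exact this i.1 i.2
    · have := h2 i.succ j.succ (by simpa using hij)
      rwa [hA] at this
  · rintro ⟨n, u⟩ hp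
    obtain ⟨h0, h1⟩ := Finset.mem_sigma.1 hp
    obtain ⟨h1, h2⟩ := Finset.mem_filter.1 h1
    simp only [Fintype.mem_piFinset, Finset.mem_Ioo] at h0 h1
    refine Finset.mem_filter.2 ⟨Fintype.mem_piFinset.2 fun i => ?_, fun i j hij => ?_⟩
    · rw [Finset.mem_Ioo]
      refine Fin.cases ?_ (fun i => ?_) i
      · exact h0
      · have := h1 i
        simp only [Fin.cons_succ]
        split_ifs at this <;> omega
    · revert hij
      refine Fin.cases ?_ (fun i => ?_) i <;> refine Fin.cases ?_ (fun j => ?_) j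
      · intro h; simp at h
      · intro _
        have := (h1 j).1
        simp only [Fin.cons_succ, Fin.cons_zero]
        split_ifs at this with h
        · exact ⟨by omega, fun h' => absurd h h'⟩
        · exact ⟨this.le, fun _ => this⟩
      · intro h; simp at h
      · intro h
        rw [hA]
        exact h2 i j (by simpa using h)
  · intro u _
    simp
  · rintro ⟨n, u⟩ _
    simp
  · intro u _
    rw [prod_mul_prod_compl, prod_mul_prod_compl, Fin.prod_univ_succ]
    simp only [hA, Fin.tail]

theorem diamondFrom_cons (N m k : ℕ) (c : List ℕ) :
    diamondFrom N m (k :: c) = ∑ n ∈ Finset.Ioo m N,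
      ((if k = 1 then 1 / ((N : ℚ) - n) * diamondFrom N (n - 1) c else 0) +
        1 / (n : ℚ) ^ k * diamondFrom N n c) := by
  set S := Finset.univ.filter fun i : Fin c.length => c.get i = 1 with hS
  have h0 : (0 : Fin (c.length + 1)) ∉ S.image Fin.succ := by simp
  have hinj : Set.InjOn (fun A : Finset (Fin c.length) => A.image Fin.succ) S.powerset :=
    (Finset.image_injective (Fin.succ_injective _)).injOn
  have h1 : ∑ A ∈ (S.image Fin.succ).powerset, diamondTerm N m (k :: c).get A =
      ∑ n ∈ Finset.Ioo m N, 1 / (n : ℚ) ^ k * diamondFrom N n c := by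
    rw [Finset.powerset_image, Finset.sum_image hinj]
    simp only [diamondFrom, Finset.mul_sum]
    rw [Finset.sum_comm]
    refine Finset.sum_congr rfl fun A _ => ?_
    refine (diamondTerm_succ N m (k :: c).get (A.image Fin.succ) A (by simp)).trans
      (Finset.sum_congr rfl fun n _ => ?_)
    rw [if_neg (by simp), if_neg (by simp)]
    rfl
  have h2 : ∑ A ∈ (S.image Fin.succ).powerset,
      diamondTerm N m (k :: c).get (insert (0 : Fin (c.length + 1)) A) =
      ∑ n ∈ Finset.Ioo m N, 1 / ((N : ℚ) - n) * diamondFrom N (n - 1) c := by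
    rw [Finset.powerset_image, Finset.sum_image hinj]
    simp only [diamondFrom, Finset.mul_sum]
    rw [Finset.sum_comm]
    refine Finset.sum_congr rfl fun A _ => ?_
    refine (diamondTerm_succ N m (k :: c).get (insert 0 (A.image Fin.succ)) A
      (by simp [Fin.succ_ne_zero])).trans (Finset.sum_congr rfl fun n _ => ?_)
    rw [if_pos (by simp), if_pos (by simp)]
    rfl
  rw [diamondFrom, Finset.sum_add_distrib, ← h1]
  by_cases hk : k = 1
  · have hU : (Finset.univ.filter fun i : Fin (k :: c).length => (k :: c).get i = 1) =
        insert (0 : Fin (c.length + 1)) (S.image Fin.succ) := by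
      ext i
      refine Fin.cases ?_ (fun i => ?_) i
      · simp [hk]
      · simp [hS, Fin.succ_ne_zero]
    rw [hU]
    refine (Finset.sum_powerset_insert h0 _).trans ?_
    rw [h2, add_comm]
    simp only [hk, if_true]
  · have hU : (Finset.univ.filter fun i : Fin (k :: c).length => (k :: c).get i = 1) =
        S.image Fin.succ := by
      ext i
      refine Fin.cases ?_ (fun i => ?_) i
      · simp [hk]
      · simp [hS]
    rw [hU]
    simp only [hk, if_false, Finset.sum_const_zero, zero_add]
    rfl

theorem diamondFrom_nil (N m : ℕ) : diamondFrom N m [] = 1 := by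
  simp [diamondFrom, diamondTerm]

/-- An entry 1 is followed by a weak step with weight 1/(N-n) if its position is in A, and by a
strict step with weight 1/n otherwise; this is b(n) = 1/n. The entry k+1 ≥ 2 is never in A, and
1/n^{k+1} supplies a(n) = 1/n. -/
theorem diamondFrom_row (N : ℕ) (k : ℕ) (hk : 1 ≤ k) (c : List ℕ) (t : ℕ) : ∀ m,
    diamondFrom N m (List.replicate t 1 ++ [k + 1] ++ c) =
      rowSum (fun n => 1 / n) N (fun n => 1 / n * (1 / (n : ℚ) ^ k * diamondFrom N n c)) t m := by
  induction t with
  | zero =>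
    intro m
    rw [List.replicate_zero, List.nil_append, List.singleton_append, diamondFrom_cons, rowSum]
    refine Finset.sum_congr rfl fun n _ => ?_
    rw [if_neg (by omega), zero_add, pow_succ]
    ring
  | succ t ih =>
    intro m
    rw [List.replicate_succ, List.cons_append, List.cons_append, diamondFrom_cons, rowSum]
    refine Finset.sum_congr rfl fun n _ => ?_
    rw [if_pos rfl, ih, ih, pow_one]

theorem diamondFrom_eq (N : ℕ) {r : ℕ} : ∀ (l k : Fin r → ℕ), (∀ j, 1 ≤ k j) → ∀ m,
    diamondFrom N m (List.ofFn fun j => List.replicate (l j - 1) 1 ++ [k j + 1]).flatten =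
      coeffSum (fun n => 1 / n) (fun n => 1 / n) N
        (List.ofFn fun j => [l j, k j]).flatten m := by
  induction r with
  | zero =>
    intro l k _ m
    rw [List.ofFn_zero, List.ofFn_zero, List.flatten_nil, diamondFrom_nil,
      coeffSum]
  | succ r ih =>
    intro l k hk m
    rw [List.ofFn_succ, List.flatten_cons, diamondFrom_row N _ (hk 0), List.ofFn_succ,
      List.flatten_cons, List.cons_append, List.singleton_append, coeffSum]
    simp only [ih _ _ fun j : Fin r => hk j.succ]

/-! ### Recursion of `ζ_N(k)` in the last entry -/

/-- `ζ_N(k_1, …, k_r)` for an index given as a function. -/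
def zetaFun (N : ℕ) {r : ℕ} (k : Fin r → ℕ) : ℚ :=
  ∑ n ∈ (Fintype.piFinset fun _ : Fin r => Finset.Ioo 0 N) with ∀ i j : Fin r, i < j → n i < n j,
    ∏ j, 1 / (n j : ℚ) ^ k j

theorem zetaN_eq_zetaFun (N : ℕ) (k : List ℕ) {r : ℕ} (h : k.length = r) (g : Fin r → ℕ)
    (hg : ∀ i, g i = k.get (i.cast h.symm)) : zetaN N k = zetaFun N g := by
  subst h
  obtain rfl : g = k.get := funext hg
  rfl

theorem zetaFun_succ (N : ℕ) {r : ℕ} (k : Fin (r + 1) → ℕ) :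
    zetaFun N k = ∑ t ∈ Finset.Ioo 0 N,
      1 / (t : ℚ) ^ k (Fin.last r) * zetaFun t fun i => k i.castSucc := by
  simp only [zetaFun, Finset.mul_sum]
  rw [Finset.sum_sigma']
  refine Finset.sum_bij' (fun u _ => ⟨u (Fin.last r), Fin.init u⟩)
    (fun p _ => Fin.snoc (α := fun _ => ℕ) p.2 p.1) ?_ ?_ ?_ ?_ ?_
  · intro u hu
    obtain ⟨h1, h2⟩ := Finset.mem_filter.1 hu
    rw [Fintype.mem_piFinset] at h1
    refine Finset.mem_sigma.2 ⟨h1 _, Finset.mem_filter.2 ⟨Fintype.mem_piFinset.2 fun i => ?_,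
      fun i j hij => h2 _ _ (by simpa using hij)⟩⟩
    exact Finset.mem_Ioo.2 ⟨(Finset.mem_Ioo.1 (h1 _)).1, h2 _ _ (Fin.castSucc_lt_last i)⟩
  · rintro ⟨t, u⟩ hp
    obtain ⟨h0, h1⟩ := Finset.mem_sigma.1 hp
    obtain ⟨h1, h2⟩ := Finset.mem_filter.1 h1
    simp only [Fintype.mem_piFinset, Finset.mem_Ioo] at h0 h1
    refine Finset.mem_filter.2 ⟨Fintype.mem_piFinset.2 fun i => ?_, fun i j => ?_⟩
    · rw [Finset.mem_Ioo]
      refine Fin.lastCases ?_ (fun i => ?_) i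
      · simpa using h0
      · have := h1 i
        simp only [Fin.snoc_castSucc]
        omega
    · refine Fin.lastCases ?_ (fun i => ?_) i <;> refine Fin.lastCases ?_ (fun j => ?_) j
      · intro h; exact absurd h (lt_irrefl _)
      · intro h; exact absurd h (Fin.castSucc_lt_last j).not_gt
      · intro _
        simpa using (h1 i).2
      · intro h
        simpa using h2 i j (by simpa using h)
  · intro u _
    simp
  · rintro ⟨t, u⟩ _
    simp
  · intro u _
    rw [Fin.prod_univ_castSucc, mul_comm]
    rfl

theorem zetaN_append (N : ℕ) (c : List ℕ) (k : ℕ) :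
    zetaN N (c ++ [k]) = ∑ t ∈ Finset.Ioo 0 N, 1 / (t : ℚ) ^ k * zetaN t c := by
  rw [zetaN_eq_zetaFun N (c ++ [k]) (r := c.length + 1) (by simp)
    (Fin.snoc (α := fun _ => ℕ) c.get k), zetaFun_succ]
  · refine Finset.sum_congr rfl fun t _ => ?_
    simp only [Fin.snoc_last, Fin.snoc_castSucc]
    rfl
  · intro i
    refine Fin.lastCases ?_ (fun i => ?_) i
    · simp
    · simp

theorem zetaN_nil (N : ℕ) : zetaN N [] = 1 := by
  simp [zetaN]

/-- The only new value of the last summation variable is N. -/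
theorem zetaN_succ_append {N : ℕ} (hN : 1 ≤ N) (c : List ℕ) (k : ℕ) :
    zetaN (N + 1) (c ++ [k]) = zetaN N (c ++ [k]) + 1 / (N : ℚ) ^ k * zetaN N c := by
  have : Finset.Ioo 0 (N + 1) = insert N (Finset.Ioo 0 N) := by ext i; simp; omega
  rw [zetaN_append, zetaN_append, this, Finset.sum_insert (by simp), add_comm]

/-! ### The evaluation map on words -/

/-- The extension of `Z_N` to all of `𝔥`. -/
noncomputable def zetaLin (N : ℕ) : NCPoly →ₗ[ℤ] ℚ :=
  (FreeAlgebra.basisFreeMonoid ℤ Letter).constr ℤ fun w => zetaN N (wordIndex w)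

theorem ZN_apply (N : ℕ) (w : hOne) : ZN N w = zetaLin N w := rfl

theorem zetaLin_lift (N : ℕ) (w : FreeMonoid Letter) :
    zetaLin N (FreeMonoid.lift (FreeAlgebra.ι ℤ) w) = zetaN N (wordIndex w) := by
  rw [← basisFreeMonoid_apply]
  exact (FreeAlgebra.basisFreeMonoid ℤ Letter).constr_basis ℤ (fun w => zetaN N (wordIndex w)) w

theorem linearMap_ext {f g : NCPoly →ₗ[ℤ] ℚ}
    (h : ∀ w, f (FreeMonoid.lift (FreeAlgebra.ι ℤ) w) = g (FreeMonoid.lift (FreeAlgebra.ι ℤ) w)) :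
    f = g :=
  (FreeAlgebra.basisFreeMonoid ℤ Letter).ext fun w =>
    (congrArg f (basisFreeMonoid_apply w)).trans
      ((h w).trans (congrArg g (basisFreeMonoid_apply w)).symm)

theorem zetaLin_one (N : ℕ) : zetaLin N 1 = 1 := by
  have := zetaLin_lift N 1
  rw [map_one] at this
  rw [this]
  exact zetaN_nil N

theorem scanWord_append (u : List Letter) (j : ℕ) :
    (scanWord (u ++ Letter.y :: List.replicate j Letter.x)).2 = (scanWord u).2 ++ [j + 1] ∧
    (scanWord (u ++ Letter.y :: List.replicate j Letter.x)).1 = (scanWord u).1 := by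
  induction u with
  | nil =>
    have := scanWord_replicate j []
    simp only [List.append_nil] at this
    simp [scanWord, this]
  | cons a u ih =>
    cases a <;> simp [scanWord, ih]

theorem Y_mul_X_pow (j : ℕ) : Y * X ^ j = FreeMonoid.lift (FreeAlgebra.ι ℤ)
    (FreeMonoid.ofList (Letter.y :: List.replicate j Letter.x)) := by
  simp [FreeMonoid.lift_apply, X, Y]

theorem zetaLin_lift_mul (N : ℕ) (w : FreeMonoid Letter) (j : ℕ) :
    zetaLin N (FreeMonoid.lift (FreeAlgebra.ι ℤ) w * (Y * X ^ j)) =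
      zetaN N (wordIndex w ++ [j + 1]) := by
  rw [Y_mul_X_pow, ← map_mul, zetaLin_lift, wordIndex, FreeMonoid.toList_mul,
    FreeMonoid.toList_ofList, (scanWord_append _ _).1]
  rfl

theorem zetaLin_succ_mul {N : ℕ} (hN : 1 ≤ N) (w : NCPoly) (j : ℕ) :
    zetaLin (N + 1) (w * (Y * X ^ j)) =
      zetaLin N (w * (Y * X ^ j)) + (1 / (N : ℚ)) ^ (j + 1) * zetaLin N w := by
  have : zetaLin (N + 1) ∘ₗ LinearMap.mulRight ℤ (Y * X ^ j) =
      zetaLin N ∘ₗ LinearMap.mulRight ℤ (Y * X ^ j) + (1 / (N : ℚ)) ^ (j + 1) • zetaLin N := by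
    refine linearMap_ext fun u => ?_
    simp only [LinearMap.comp_apply, LinearMap.mulRight_apply, LinearMap.add_apply,
      LinearMap.smul_apply, zetaLin_lift_mul, zetaLin_lift, zetaN_succ_append hN, smul_eq_mul,
      one_div, inv_pow]
  exact congrArg (fun f => f w) this

theorem exists_append_replicate (u : List Letter) : ∃ p j,
    Letter.y :: u = p ++ Letter.y :: List.replicate j Letter.x := by
  induction u with
  | nil => exact ⟨[], 0, rfl⟩
  | cons a u ih =>
    obtain ⟨p, j, h⟩ := ih
    cases a with
    | y => exact ⟨Letter.y :: p, j, by rw [h]; rfl⟩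
    | x =>
      cases p with
      | nil =>
        simp only [List.nil_append, List.cons.injEq, true_and] at h
        exact ⟨[], j + 1, by rw [h]; rfl⟩
      | cons b p =>
        simp only [List.cons_append, List.cons.injEq] at h
        exact ⟨Letter.y :: Letter.x :: p, j, by rw [h.2]; rfl⟩

theorem exists_Y_mul_lift (u : FreeMonoid Letter) : ∃ (p : NCPoly) (j : ℕ),
    Y * FreeMonoid.lift (FreeAlgebra.ι ℤ) u = p * (Y * X ^ j) := by
  obtain ⟨p, j, h⟩ := exists_append_replicate (FreeMonoid.toList u)
  refine ⟨FreeMonoid.lift (FreeAlgebra.ι ℤ) (FreeMonoid.ofList p), j, ?_⟩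
  have hY : Y = FreeMonoid.lift (FreeAlgebra.ι ℤ) (FreeMonoid.of Letter.y) := by simp [Y]
  rw [Y_mul_X_pow, hY, ← map_mul, ← map_mul]
  congr 1

/-- The span of the words that start with `y`. -/
noncomputable def hPlus : Submodule ℤ NCPoly := LinearMap.range (LinearMap.mulLeft ℤ Y)

theorem mul_mem_hPlus {w : NCPoly} (hw : w ∈ hPlus) (v : NCPoly) : w * v ∈ hPlus := by
  obtain ⟨u, rfl⟩ := hw
  exact ⟨u * v, by simp [mul_assoc]⟩

/-- A word that starts with y has the form p y x^j. Right multiplication by x raises j by one, which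
costs the increment from N to N+1 a factor 1/N. -/
theorem zetaLin_succ_mul_X {N : ℕ} (hN : 1 ≤ N) {w : NCPoly} (hw : w ∈ hPlus) :
    zetaLin (N + 1) (w * X) - zetaLin N (w * X) =
      1 / (N : ℚ) * (zetaLin (N + 1) w - zetaLin N w) := by
  obtain ⟨u, rfl⟩ := hw
  have : (zetaLin (N + 1) - zetaLin N) ∘ₗ LinearMap.mulRight ℤ X ∘ₗ LinearMap.mulLeft ℤ Y =
      (1 / (N : ℚ)) • ((zetaLin (N + 1) - zetaLin N) ∘ₗ LinearMap.mulLeft ℤ Y) := by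
    refine linearMap_ext fun u => ?_
    obtain ⟨p, j, h⟩ := exists_Y_mul_lift u
    simp only [LinearMap.comp_apply, LinearMap.mulRight_apply, LinearMap.mulLeft_apply,
      LinearMap.sub_apply, LinearMap.smul_apply, h]
    rw [mul_assoc p, mul_assoc Y, ← pow_succ, zetaLin_succ_mul hN, zetaLin_succ_mul hN, smul_eq_mul]
    ring
  exact congrArg (fun f => f u) this

theorem zetaLin_succ_mul_X_pow {N : ℕ} (hN : 1 ≤ N) {w : NCPoly} (hw : w ∈ hPlus) (j : ℕ) :
    zetaLin (N + 1) (w * X ^ j) - zetaLin N (w * X ^ j) =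
      (1 / (N : ℚ)) ^ j * (zetaLin (N + 1) w - zetaLin N w) := by
  induction j with
  | zero => simp
  | succ j ih =>
    rw [pow_succ X, ← mul_assoc, zetaLin_succ_mul_X hN (mul_mem_hPlus hw _), ih]
    ring

theorem zetaLin_one_of_mem {w : NCPoly} (hw : w ∈ hPlus) : zetaLin 1 w = 0 := by
  obtain ⟨u, rfl⟩ := hw
  have : zetaLin 1 ∘ₗ LinearMap.mulLeft ℤ Y = 0 := by
    refine linearMap_ext fun u => ?_
    have hY : Y = FreeMonoid.lift (FreeAlgebra.ι ℤ) (FreeMonoid.of Letter.y) := by simp [Y]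
    rw [LinearMap.comp_apply, LinearMap.mulLeft_apply, hY, ← map_mul, zetaLin_lift,
      LinearMap.zero_apply]
    obtain ⟨p, j, h⟩ := exists_append_replicate (FreeMonoid.toList u)
    have h' : wordIndex (FreeMonoid.of Letter.y * u) = (scanWord p).2 ++ [j + 1] := by
      rw [wordIndex, FreeMonoid.toList_mul, FreeMonoid.toList_of, List.singleton_append, h,
        (scanWord_append _ _).1]
    rw [h', zetaN_append, show Finset.Ioo 0 1 = ∅ by rfl, Finset.sum_empty]
  exact congrArg (fun f => f u) this

/-! ### Shapes of the reduced indices -/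

theorem length_reduce_empty (c : List ℕ) (B : Finset ℕ) : (reduce c ∅ B).length = c.length := by
  rw [reduce, reduceFrom_eq]
  simp

theorem reduce_empty_empty (c : List ℕ) : reduce c ∅ ∅ = c := by
  have : ∀ s, reduceFrom s c ∅ ∅ = c := by
    induction c with
    | nil => intro s; simp [reduceFrom]
    | cons a c ih => intro s; simp [reduceFrom_cons, ih]
  exact this 1

theorem one_le_of_mem_reduce {c : List ℕ} (hc : ∀ i ∈ c, 1 ≤ i) {A B : Finset ℕ}
    (hB : B ⊆ gtPos c) : ∀ i ∈ reduce c A B, 1 ≤ i := by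
  intro i hi
  rw [reduce, reduceFrom_eq] at hi
  obtain ⟨j, hj, rfl⟩ := List.mem_map.1 hi
  have hj := List.mem_range'_1.1 (List.mem_filter.1 hj).1
  split_ifs with h
  · have := (Finset.mem_filter.1 (hB h)).2
    omega
  · rw [List.getD_eq_getElem _ _ (by omega)]
    exact hc _ (List.getElem_mem _)

theorem even_of_isTiled {A : Finset ℕ} (h : IsTiled A) (t : ℕ) : ∀ s,
    A ⊆ Finset.Icc 1 (2 * (s + t)) →
    2 ∣ ∑ i ∈ Finset.Ico (2 * s + 1) (2 * (s + t) + 1), (if i ∈ A then 1 else 0) + pending A s := by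
  induction t with
  | zero =>
    intro s hA
    have hA1 : 2 * s + 1 ∉ A := fun hi' => by
      have := Finset.mem_Icc.1 (hA hi'); omega
    simp [pending, hA1]
  | succ t ih =>
    intro s hA
    have ih := ih (s + 1) (by rwa [show s + 1 + t = s + (t + 1) by ring])
    rw [Finset.sum_eq_sum_Ico_succ_bot (by omega), Finset.sum_eq_sum_Ico_succ_bot (by omega)]
    rw [show s + 1 + t = s + (t + 1) by ring, show 2 * (s + 1) + 1 = 2 * s + 1 + 1 + 1 by ring] at ih
    generalize ∑ i ∈ Finset.Ico (2 * s + 1 + 1 + 1) (2 * (s + (t + 1)) + 1),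
      (if i ∈ A then 1 else 0) = Q at *
    have h' := h s
    simp only [pending, show 2 * (s + 1) = 2 * s + 2 by ring,
      show 2 * s + 1 + 1 = 2 * s + 2 by ring, show 2 * s + 2 + 1 = 2 * s + 3 by ring] at ih ⊢
    by_cases h0 : 2 * s ∈ A <;> by_cases h1 : 2 * s + 1 ∈ A <;> by_cases h2 : 2 * s + 2 ∈ A <;>
      by_cases h3 : 2 * s + 3 ∈ A <;>
      simp only [h0, h1, h2, h3, if_true, if_false, true_and, and_true, and_false, false_and]
        at ih ⊢ h' <;>
      first
      | (simp at h'; done)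
      | omega

/-- By parity #A + #B ≤ 1 forces A = ∅, and 2κ(A) = #A bounds the exponents of x when ε = 1. -/
theorem two_dvd_card {r : ℕ} {A : Finset ℕ} (hA : A ∈ Tilings r) : 2 ∣ A.card := by
  obtain ⟨hA, h⟩ := mem_Tilings.1 hA
  have h0 : 2 * 0 ∉ A := fun h => by simpa using hA h
  have := even_of_isTiled h r 0 (by simpa using hA)
  rw [pending, if_neg fun h' => h0 h'.1, add_zero, ← Finset.sum_filter,
    ← Finset.card_eq_sum_ones] at this
  convert this using 2
  ext i
  simp only [Finset.mem_filter, Finset.mem_Ico]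
  constructor
  · intro h
    have := Finset.mem_Icc.1 (hA h)
    exact ⟨by omega, h⟩
  · exact fun h => h.2

theorem length_reduce {c : List ℕ} {A B : Finset ℕ} (hA : A ⊆ Finset.Icc 1 c.length) :
    (reduce c A B).length + A.card = c.length := by
  rw [reduce, reduceFrom_eq, List.length_map, ← List.toFinset_card_of_nodup
    ((List.nodup_range' ..).filter _)]
  have : ((List.range' 1 c.length).filter fun i => i ∉ A).toFinset =
      Finset.Icc 1 c.length \ A := by
    ext i; simp; omega
  rw [this, Finset.card_sdiff_add_card_eq_card hA]
  simp

/-! ### The words lie in `𝔥¹` and `𝔥^{≥2}` -/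

/-- In the first sum the index keeps its length, so the factor before the power of x is again the
word of a nonempty index; in the other two sums a factor y is present even when the reduced index is
empty. -/
theorem wordE_mem_hPlus (ε : ℕ) (c : List ℕ) : c ≠ [] → wordE ε c ∈ hPlus := by
  induction h : c.sum + c.length using Nat.strong_induction_on generalizing c with
  | _ n ih =>
    intro hc
    subst h
    have hB : ∀ B, reduce c ∅ B ≠ [] := fun B hB => hc <| by
      rw [← List.length_eq_zero_iff, ← length_reduce_empty c B, hB]; rfl
    have hY : ∀ c' : List ℕ, c'.sum + c'.length < c.sum + c.length → ∀ j,
        wordE ε c' * (Y * X ^ j) ∈ hPlus := by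
      intro c' hc' j
      rcases eq_or_ne c' [] with rfl | h
      · rw [wordE_nil, one_mul]
        exact ⟨X ^ j, rfl⟩
      · exact mul_mem_hPlus (ih _ hc' _ rfl h) _
    rw [wordE_eq ε hc]
    refine add_mem (sub_mem (neg_mem (sum_mem fun B h => ?_)) (sum_mem fun B h => ?_))
      (sum_mem fun p h => ?_)
    · exact Submodule.smul_mem _ _ (mul_mem_hPlus (ih _ (indexOne_lt h) _ rfl (hB B)) _)
    · exact Submodule.smul_mem _ _ (hY _ (indexTwo_lt h) _)
    · exact Submodule.smul_mem _ _ (hY _ (indexThree_lt h) _)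

/-- The subspace `yx ℤ⟨x, yx⟩`. -/
noncomputable def hGeTwoPlus : Submodule ℤ NCPoly :=
  (Subalgebra.toSubmodule (Algebra.adjoin ℤ {X, Y * X})).map (LinearMap.mulLeft ℤ (Y * X))

theorem mul_mem_hGeTwoPlus {w v : NCPoly} (hw : w ∈ hGeTwoPlus)
    (hv : v ∈ Algebra.adjoin ℤ {X, Y * X}) : w * v ∈ hGeTwoPlus := by
  obtain ⟨u, hu, rfl⟩ := hw
  exact ⟨u * v, Subalgebra.mul_mem _ hu hv, by simp [mul_assoc]⟩

theorem X_pow_mem (j : ℕ) : X ^ j ∈ Algebra.adjoin ℤ {X, Y * X} :=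
  pow_mem (Algebra.subset_adjoin (by simp)) j

/-- Every explicit y is followed by at least one x: the exponents are #B-1 and 2κ(A)+#B-1 = #A+#B-1,
both positive by the size conditions. -/
theorem wordE_one_mem_hGeTwoPlus (c : List ℕ) : c ≠ [] → wordE 1 c ∈ hGeTwoPlus := by
  induction h : c.sum + c.length using Nat.strong_induction_on generalizing c with
  | _ n ih =>
    intro hc
    subst h
    have hB : ∀ B, reduce c ∅ B ≠ [] := fun B hB => hc <| by
      rw [← List.length_eq_zero_iff, ← length_reduce_empty c B, hB]; rfl
    have hY : ∀ c' : List ℕ, c'.sum + c'.length < c.sum + c.length → ∀ j, 1 ≤ j →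
        wordE 1 c' * (Y * X ^ j) ∈ hGeTwoPlus := by
      intro c' hc' j hj
      obtain ⟨j, rfl⟩ : ∃ i, j = i + 1 := ⟨j - 1, by omega⟩
      rw [pow_succ', ← mul_assoc Y]
      rcases eq_or_ne c' [] with rfl | h
      · rw [wordE_nil, one_mul]
        exact ⟨X ^ j, X_pow_mem j, rfl⟩
      · exact mul_mem_hGeTwoPlus (ih _ hc' _ rfl h)
          (mul_mem (Algebra.subset_adjoin (by simp)) (X_pow_mem j))
    rw [wordE_eq 1 hc]
    refine add_mem (sub_mem (neg_mem (sum_mem fun B h => ?_)) (sum_mem fun B h => ?_))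
      (sum_mem fun p h => ?_)
    · exact Submodule.smul_mem _ _
        (mul_mem_hGeTwoPlus (ih _ (indexOne_lt h) _ rfl (hB B)) (X_pow_mem _))
    · have := (Finset.mem_filter.1 h).2.2
      exact Submodule.smul_mem _ _ (hY _ (indexTwo_lt h) _ (by omega))
    · have h' := (Finset.mem_filter.1 h).2
      have := two_dvd_card h'.1
      have := h'.2.2
      refine Submodule.smul_mem _ _ (hY _ (indexThree_lt h) _ ?_)
      rw [kappa]
      omega

/-! ### Comparison of the two difference equations -/

theorem oe_eq_zero_of_card_le_one {S : Finset ℕ} (h : S.card ≤ 1) : oe S = 0 := by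
  rw [oe_eq_zero_iff]
  rintro j ⟨h1, h2⟩
  have := Finset.card_le_one.1 h _ h1 _ h2
  omega

theorem eo_eq_zero_of_card_le_one {S : Finset ℕ} (h : S.card ≤ 1) : eo S = 0 := by
  rw [eo_eq_zero_iff]
  rintro j _ ⟨h1, h2⟩
  have := Finset.card_le_one.1 h _ h1 _ h2
  omega

theorem sum_indexOne (c : List ℕ) (f : Finset ℕ → ℚ) :
    ∑ B ∈ (gtPos c).powerset with eo B = 0, f B = f ∅ + ∑ B ∈ indexOne c, f B := by
  have h : (gtPos c).powerset.filter (fun B => eo B = 0) = insert ∅ (indexOne c) := by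
    ext B
    simp only [indexOne, Finset.mem_filter, Finset.mem_insert, Finset.mem_powerset]
    have : eo ∅ = 0 := eo_eq_zero_of_card_le_one (by simp)
    constructor
    · intro h
      by_cases hB : B = ∅
      · exact Or.inl hB
      · exact Or.inr ⟨h.1, h.2, hB⟩
    · rintro (rfl | h)
      · exact ⟨by simp, this⟩
      · exact ⟨h.1, h.2.1⟩
  rw [h, Finset.sum_insert (by simp [indexOne])]

/-- Sets with at most one element meet both parity conditions. They are separated here and in
`sum_indexThree` so that they cancel. -/
theorem sum_indexTwo (c : List ℕ) (f : Finset ℕ → ℚ) :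
    ∑ B ∈ (gtPos c).powerset with eo B = 0, f B =
      ∑ B ∈ indexTwo c, f B + ∑ B ∈ (gtPos c).powerset with B.card ≤ 1, f B := by
  rw [← Finset.sum_filter_add_sum_filter_not _ fun B => 2 ≤ B.card, Finset.filter_filter,
    Finset.filter_filter]
  congr 1
  refine Finset.sum_congr (Finset.filter_congr fun B _ => ?_) fun _ _ => rfl
  exact ⟨fun h => by omega, fun h => ⟨eo_eq_zero_of_card_le_one h, by omega⟩⟩

theorem sum_indexThree (c : List ℕ) (f : Finset ℕ × Finset ℕ → ℚ) :
    ∑ p ∈ (onePos c).powerset ×ˢ (gtPos c).powerset with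
        p.1 ∈ Tilings (c.length / 2) ∧ oe (p.2.image (sigma p.1)) = 0, f p =
      ∑ p ∈ indexThree c, f p + ∑ B ∈ (gtPos c).powerset with B.card ≤ 1, f (∅, B) := by
  have hsmall : ∑ B ∈ (gtPos c).powerset with B.card ≤ 1, f (∅, B) =
      ∑ p ∈ ((gtPos c).powerset.filter fun B => B.card ≤ 1).image (Prod.mk ∅), f p :=
    (Finset.sum_image fun _ _ _ _ h => (Prod.mk.inj h).2).symm
  rw [hsmall, ← Finset.sum_union]
  · refine Finset.sum_congr (Finset.ext ?_) fun _ _ => rfl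
    rintro ⟨A, B⟩
    simp only [indexThree, Finset.mem_union, Finset.mem_filter, Finset.mem_product,
      Finset.mem_powerset, Finset.mem_image, Prod.mk.injEq]
    constructor
    · rintro ⟨hAB, hA, hB⟩
      by_cases h2 : 2 ≤ A.card + B.card
      · exact Or.inl ⟨hAB, hA, hB, h2⟩
      · have := two_dvd_card hA
        exact Or.inr ⟨B, ⟨hAB.2, by omega⟩, (Finset.card_eq_zero.1 (by omega)).symm, rfl⟩
    · rintro (⟨hAB, hA, hB, -⟩ | ⟨B, ⟨hB, hB1⟩, rfl, rfl⟩)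
      · exact ⟨hAB, hA, hB⟩
      · exact ⟨⟨Finset.empty_subset _, hB⟩, mem_Tilings.2 ⟨by simp, fun j => by simp⟩,
          oe_eq_zero_of_card_le_one (Finset.card_image_le.trans hB1)⟩
  · rw [Finset.disjoint_left]
    rintro ⟨A, B⟩ h1 h2
    simp only [indexThree, Finset.mem_filter, Finset.mem_image, Prod.mk.injEq] at h1 h2
    obtain ⟨B, ⟨-, hB1⟩, rfl, rfl⟩ := h2
    have := h1.2.2.2
    rw [Finset.card_empty] at this
    omega

/-- The coefficients `1 / n ^ ε` of the last entries of the rows. -/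
def lastCoeff (ε n : ℕ) : ℚ := if ε = 0 then 1 else 1 / n

/-- The coefficients of the strict steps inside a row. -/
def stepCoeff (ε n : ℕ) : ℚ := if ε = 0 then 0 else 1 / n

/-- For ε = 1 this is 1/m = (1/N)(1 + (N-m)/m). -/
theorem lastCoeff_eq {ε : ℕ} (hε : ε ≤ 1) {N m : ℕ} (hm : 1 ≤ m) (hN : m ≤ N) :
    lastCoeff ε m = (1 / (N : ℚ)) ^ ε * (1 + stepCoeff ε m * (N - m)) := by
  have hm' : (m : ℚ) ≠ 0 := Nat.cast_ne_zero.2 (by omega)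
  have hN' : (N : ℚ) ≠ 0 := Nat.cast_ne_zero.2 (by omega)
  interval_cases ε
  · simp [lastCoeff, stepCoeff]
  · simp only [lastCoeff, stepCoeff, one_ne_zero, if_false]
    field_simp
    ring

/-- Outer induction on N, inner induction on the size of c: in the difference equation the values at
N+1 other than that of c itself occur only at the smaller indices of the first sum. The start is N =
1, since the equation divides by N. -/
theorem zetaLin_wordE {ε : ℕ} (hε : ε ≤ 1) (N : ℕ) (hN : 1 ≤ N) : ∀ c : List ℕ,
    (∀ i ∈ c, 1 ≤ i) → 2 ∣ c.length →
    zetaLin N (wordE ε c) = coeffSum (lastCoeff ε) (stepCoeff ε) N c 0 := by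
  induction N, hN using Nat.le_induction with
  | base =>
    intro c _ hlen
    match c with
    | [] => rw [wordE_nil, zetaLin_one, coeffSum]
    | [_] => simp at hlen
    | l :: k :: c =>
      rw [zetaLin_one_of_mem (wordE_mem_hPlus ε _ (by simp)), coeffSum,
        rowSum_of_le _ _ _ _ (by omega)]
  | succ N hN ihN =>
    intro c
    induction h : c.sum + c.length using Nat.strong_induction_on generalizing c with
    | _ n ih =>
      intro hc hlen
      subst h
      rcases eq_or_ne c [] with rfl | hc0
      · rw [wordE_nil, zetaLin_one, coeffSum]
      obtain ⟨r, hr⟩ := hlen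
      have hr1 : 1 ≤ r := by
        by_contra h
        exact hc0 (List.length_eq_zero_iff.1 (by omega))
      have hr2 : c.length / 2 = r := by omega
      set a := lastCoeff ε
      set b := stepCoeff ε
      set t := 1 / (N : ℚ) with ht
      have hmain := coeffSum_succ a b (t ^ ε) hN hr1
        (fun m hm hm' => lastCoeff_eq hε hm hm') hc hr
      have hB0 : ∀ B, reduce c ∅ B ≠ [] := fun B hB => hc0 <| by
        rw [← List.length_eq_zero_iff, ← length_reduce_empty c B, hB]; rfl
      have hval : ∀ A B, A ∈ Tilings r → B ⊆ gtPos c →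
          zetaLin N (wordE ε (reduce c A B)) = coeffSum a b N (reduce c A B) 0 := by
        intro A B hA hB
        have h1 := length_reduce (B := B) (hr ▸ (mem_Tilings.1 hA).1 : A ⊆ Finset.Icc 1 c.length)
        have h2 := two_dvd_card hA
        exact ihN _ (one_le_of_mem_reduce hc hB) (by omega)
      have hempty : ∅ ∈ Tilings r := mem_Tilings.2 ⟨by simp, fun j => by simp⟩
      rw [← hr2, sum_indexThree, sum_indexOne] at hmain
      -- The sum over eo(B) = 0 at level N, split in two ways; subtracting it from `hmain` removes
      -- the terms with A = ∅, #B ≤ 1 and produces the second sum of the recursion.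
      have hsmall := (sum_indexOne c fun B => (-t) ^ B.card * coeffSum a b N (reduce c ∅ B) 0).symm.trans
        (sum_indexTwo c fun B => (-t) ^ B.card * coeffSum a b N (reduce c ∅ B) 0)
      simp only [reduce_empty_empty, Finset.card_empty, pow_zero, one_mul] at hmain hsmall
      have hdiff : zetaLin (N + 1) (wordE ε c) - zetaLin N (wordE ε c) =
          - (∑ B ∈ indexOne c, ((-t) ^ B.card * coeffSum a b (N + 1) (reduce c ∅ B) 0 -
            (-t) ^ B.card * coeffSum a b N (reduce c ∅ B) 0))
          - (∑ B ∈ indexTwo c, (-t) ^ B.card * coeffSum a b N (reduce c ∅ B) 0)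
          + ∑ p ∈ indexThree c, (-1) ^ eo p.1 * (t ^ ε / N) ^ kappa p.1 * ((-t) ^ p.2.card *
              coeffSum a b N (reduce c p.1 p.2) 0) := by
        rw [wordE_eq ε hc0]
        simp only [map_add, map_sub, map_neg, map_sum, map_smul]
        have hsplit : ∀ a₁ a₂ b₁ b₂ c₁ c₂ : ℚ, -a₁ - b₁ + c₁ - (-a₂ - b₂ + c₂) =
            -(a₁ - a₂) - (b₁ - b₂) + (c₁ - c₂) := fun _ _ _ _ _ _ => by ring
        rw [hsplit, ← Finset.sum_sub_distrib, ← Finset.sum_sub_distrib, ← Finset.sum_sub_distrib]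
        refine congr_arg₂ _ (congr_arg₂ _ (congr_arg _ ?_) ?_) ?_
        · refine Finset.sum_congr rfl fun B hB => ?_
          have hBg := Finset.mem_powerset.1 (Finset.mem_filter.1 hB).1
          rw [← smul_sub, zetaLin_succ_mul_X_pow hN (wordE_mem_hPlus ε _ (hB0 B)),
            hval _ _ hempty hBg, ih _ (indexOne_lt hB) _ rfl (one_le_of_mem_reduce hc hBg)
              (by rw [length_reduce_empty]; omega), zsmul_eq_mul, neg_pow t]
          push_cast
          ring
        · refine Finset.sum_congr rfl fun B hB => ?_
          obtain ⟨hBg, -, hB2⟩ := Finset.mem_filter.1 hB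
          rw [← smul_sub, zetaLin_succ_mul hN, add_sub_cancel_left,
            hval _ _ hempty (Finset.mem_powerset.1 hBg), zsmul_eq_mul, neg_pow t,
            show B.card - 1 + 1 = B.card by omega]
          push_cast
          ring
        · refine Finset.sum_congr rfl fun p hp => ?_
          obtain ⟨hpg, hpT, -, hp2⟩ := Finset.mem_filter.1 hp
          rw [hr2] at hpT
          have hpB := Finset.mem_powerset.1 (Finset.mem_product.1 hpg).2
          have hcard := two_dvd_card hpT
          have hexp : (1 + ε) * kappa p.1 + p.2.card - 1 + 1 =
              (1 + ε) * kappa p.1 + p.2.card := by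
            have : 1 ≤ (1 + ε) * kappa p.1 + p.2.card := by
              have : kappa p.1 ≤ (1 + ε) * kappa p.1 := Nat.le_mul_of_pos_left _ (by omega)
              have : kappa p.1 = p.1.card / 2 := rfl
              omega
            omega
          -- With q = N^{-ε} each domino weighs N^{-(1+ε)}, whence the exponent (1+ε)κ(A) in the
          -- words.
          have hδ : t ^ ε / N = t ^ (1 + ε) := by rw [pow_add, pow_one, ht]; ring
          rw [← smul_sub, zetaLin_succ_mul hN, add_sub_cancel_left, hval _ _ hpT hpB,
            zsmul_eq_mul, neg_pow t, hexp, hδ, ← pow_mul, pow_add]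
          push_cast
          ring
      rw [Finset.sum_sub_distrib, ihN c hc ⟨r, hr⟩] at hdiff
      have hkap : kappa ∅ = 0 := rfl
      have heo : eo ∅ = 0 := eo_eq_zero_of_card_le_one (by simp)
      simp only [hkap, heo, pow_zero, one_mul] at hmain
      linear_combination hdiff - hmain + hsmall

theorem mem_flatten_pairs {r : ℕ} {l k : Fin r → ℕ} (hl : ∀ j, 1 ≤ l j) (hk : ∀ j, 1 ≤ k j) :
    ∀ i ∈ (List.ofFn fun j => [l j, k j]).flatten, 1 ≤ i := by
  intro i hi
  obtain ⟨s, hs, his⟩ := List.mem_flatten.1 hi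
  obtain ⟨j, rfl⟩ := List.mem_ofFn.1 hs
  rcases List.mem_cons.1 his with rfl | h
  · exact hl j
  · rw [List.mem_singleton.1 h]; exact hk j

theorem length_flatten_pairs {r : ℕ} (l k : Fin r → ℕ) :
    (List.ofFn fun j => [l j, k j]).flatten.length = 2 * r := by
  induction r with
  | zero => simp
  | succ r ih =>
    rw [List.ofFn_succ, List.flatten_cons, List.length_append, ih]
    simp; ring

end MHS

theorem mainTheorem5 (r : ℕ) (l k : Fin r → ℕ) (hl : ∀ j, 1 ≤ l j) (hk : ∀ j, 1 ≤ k j) :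
    ∃ (hE : MHS.frakE (List.ofFn fun j => [l j, k j]).flatten ∈ MHS.hOne)
      (hD : MHS.frakD (List.ofFn fun j => [l j, k j]).flatten ∈ MHS.hGeTwo),
      ∀ N : ℕ, 1 ≤ N →
        MHS.zetaBinom N l k =
          MHS.ZN N ⟨MHS.frakE (List.ofFn fun j => [l j, k j]).flatten, hE⟩ ∧
        MHS.zetaDiamond N
            (List.ofFn fun j => List.replicate (l j - 1) 1 ++ [k j + 1]).flatten =
          MHS.ZN N ⟨MHS.frakD (List.ofFn fun j => [l j, k j]).flatten,
            MHS.hGeTwo_le_hOne hD⟩ := by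
  have hc := MHS.mem_flatten_pairs hl hk
  have hlen : 2 ∣ (List.ofFn fun j => [l j, k j]).flatten.length :=
    ⟨r, MHS.length_flatten_pairs l k⟩
  have hone : (1 : MHS.NCPoly) ∈ Submodule.span ℤ {(1 : MHS.NCPoly)} :=
    Submodule.mem_span_singleton_self 1
  refine ⟨?_, ?_, fun N hN => ⟨?_, ?_⟩⟩
  · rcases eq_or_ne (List.ofFn fun j => [l j, k j]).flatten [] with h | h
    · rw [h, MHS.frakE, MHS.wordE_nil]
      exact Submodule.mem_sup_left hone
    · exact Submodule.mem_sup_right (MHS.wordE_mem_hPlus 0 _ h)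
  · rcases eq_or_ne (List.ofFn fun j => [l j, k j]).flatten [] with h | h
    · rw [h, MHS.frakD, MHS.wordE_nil]
      exact Submodule.mem_sup_left hone
    · exact Submodule.mem_sup_right (MHS.wordE_one_mem_hGeTwoPlus _ h)
  · rw [MHS.ZN_apply]
    exact (MHS.binomFrom_eq N l k hl 0).trans (MHS.zetaLin_wordE (ε := 0) (by omega) N hN _ hc hlen).symm
  · rw [MHS.ZN_apply]
    exact (MHS.diamondFrom_eq N l k hk 0).trans
      (MHS.zetaLin_wordE (ε := 1) le_rfl N hN _ hc hlen).symm
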